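/- Let $1\le p\le\infty$. Let $L^p(\mathbb R^{+})$ be the subspace of the functions in $L^p(\mathbb R)$ (complex-valued) that vanish on $(-\infty,0)$. Let $P$ be multiplication by the characteristic function of $(0,\infty)$, $Q=I-P$, and $(Jf)(t)=\widetilde f(t)=f(-t)$. Let $G$ be the set of functions $$a(t)=\sum_{j\in\mathbb Z} a_j e^{i\delta_j t}+\int_{-\infty}^{\infty}k(s)e^{its}\,ds,\qquad t\in\mathbb R,$$ with pairwise distinct real $\delta_j$, $\sum_j|a_j|<\infty$ and $k\in L^1(\mathbb R)$, and let $G^{+}\subset G$ consist of those with all $\delta_j\ge 0$ and $k=0$ on $(-\infty,0)$. For such $a$ put $$(W^0(a)f)(t)=\sum_{j} a_j f(t-\delta_j)+\int_{-\infty}^{\infty}k(t-s)f(s)\,ds,\qquad f\in L^p(\mathbb R),$$ and $W(a)=PW^0(a):L^p(\mathbb R^{+})\to L^p(\mathbb R^{+})$. Let $g\in G$ be a matching function, i.e. $g(t)g(-t)=1$ for all $t\in\mathbb R$, and put $$\mathbf P(g)=JQW^0(g)P|_{\ker W(g)},\qquad \mathbf P^{\pm}(g)=\tfrac12\,(I\pm\mathbf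 P(g))\quad\text{on }\ker W(g).$$ Suppose that, for some real $\nu<0$, some integer $n>0$ and some $g_+$ with $g_+\in G^{+}$ and $g_+^{-1}\in G^{+}$, $$g(t)=\boldsymbol\sigma(g)\,g_+(-t)^{-1}\,e^{i\nu t}\Big(\frac{t-i}{t+i}\Big)^{n}g_+(t),\quad t\in\mathbb R,\qquad \boldsymbol\sigma(g):=(-1)^n g(0).$$ Then $\ker W(g)$ consists exactly of the functions $h$ of the form $$h=W(g_+^{-1})\,W\Big(\Big(\frac{t-i}{t+i}\Big)^{-n}\Big)\varphi, \tag{1}$$ where $\varphi\in L^p(\mathbb R^{+})$ is such that $$\varphi(t)=0\ \text{ for all } t>|\nu|,\qquad \int_0^\infty\varphi(t)\,t^{j}e^{-t}\,dt=0,\quad j=0,1,\dots,n-1. \tag{2}$$ Moreover, whenever $h\in\ker W(g)$ is represented in the form (1) with $\varphi$ as in (2), $$JQW^0(g)Ph=\boldsymbol\sigma(g)\,W(g_+^{-1})\mathcal R_{|\nu|}\varphi,\qquad \mathbf P^{\pm}(g)h=\frac{h\pm\boldsymbol\sigma(g)\,W(g_+^{-1})\mathcal R_{|\nu|}\varphi}{2},$$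 where $(\mathcal R_{|\nu|}\varphi)(t)=\varphi(|\nu|-t)$ for $0<t<|\nu|$ and $(\mathcal R_{|\nu|}\varphi)(t)=0$ for $t>|\nu|$. -/

import Mathlib

open MeasureTheory
open scoped ENNReal

noncomputable section

namespace WienerHopf

/-! ### Young's inequality (only used to see that convolution with a kernel is bounded) -/

theorem lintegral_young {p : ℝ≥0∞} (hp : 1 ≤ p) {K F : ℝ → ℝ≥0∞} (hK : AEMeasurable K)
    (hF : AEMeasurable F) (hKfin : ∫⁻ s, K s ≠ ∞) :
    eLpNorm (fun t : ℝ => ∫⁻ s, K (t - s) * F s) p volume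
      ≤ (∫⁻ s, K s) * eLpNorm F p volume := by
  have hKt : ∀ t : ℝ, AEMeasurable (fun s => K (t - s)) := fun t =>
    hK.comp_quasiMeasurePreserving
      (Measure.measurePreserving_sub_left volume t).quasiMeasurePreserving
  have hKint : ∀ t : ℝ, ∫⁻ s, K (t - s) = ∫⁻ s, K s := fun t =>
    lintegral_sub_left_eq_self K t
  by_cases hptop : p = ∞
  · subst hptop
    simp only [eLpNorm_exponent_top]
    refine eLpNormEssSup_le_of_ae_enorm_bound (Filter.Eventually.of_forall fun t => ?_)
    simp only [enorm_eq_self]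
    calc ∫⁻ s, K (t - s) * F s
        ≤ ∫⁻ s, K (t - s) * eLpNormEssSup F volume := by
          refine lintegral_mono_ae ?_
          filter_upwards [ae_le_eLpNormEssSup (f := F) (μ := volume)] with s hs
          simp only [enorm_eq_self] at hs
          gcongr
      _ = (∫⁻ s, K s) * eLpNormEssSup F volume := by
          rw [lintegral_mul_const'' _ (hKt t), hKint]
  · have hp0 : p ≠ 0 := (zero_lt_one.trans_le hp).ne'
    set q : ℝ := p.toReal with hq
    have hq1 : 1 ≤ q := by
      have := (ENNReal.toReal_le_toReal ENNReal.one_ne_top hptop).2 hp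
      simpa using this
    have hq0 : 0 < q := zero_lt_one.trans_le hq1
    rw [eLpNorm_eq_eLpNorm' hp0 hptop, eLpNorm_eq_eLpNorm' hp0 hptop]
    simp only [eLpNorm', enorm_eq_self, ← hq]
    set A := ∫⁻ s, K s with hA
    have key : ∀ t : ℝ, (∫⁻ s, K (t - s) * F s) ^ q
        ≤ A ^ (q - 1) * ∫⁻ s, K (t - s) * F s ^ q := by
      intro t
      have hac : volume.withDensity (fun s => K (t - s)) ≪ (volume : Measure ℝ) :=
        withDensity_absolutelyContinuous _ _
      have h1 := eLpNorm'_le_eLpNorm'_mul_rpow_measure_univ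
        (μ := volume.withDensity (fun s => K (t - s))) (f := F) zero_lt_one hq1
        (hF.mono_ac hac).aestronglyMeasurable
      simp only [eLpNorm', enorm_eq_self, ENNReal.rpow_one, div_one] at h1
      rw [lintegral_withDensity_eq_lintegral_mul₀ (hKt t) hF,
        lintegral_withDensity_eq_lintegral_mul₀ (hKt t) (hF.pow_const q),
        withDensity_apply _ MeasurableSet.univ, Measure.restrict_univ, hKint t] at h1
      simp only [Pi.mul_apply] at h1
      calc (∫⁻ s, K (t - s) * F s) ^ q
          ≤ ((∫⁻ s, K (t - s) * F s ^ q) ^ (1 / q) * A ^ (1 - 1 / q)) ^ q := by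
            gcongr
        _ = A ^ (q - 1) * ∫⁻ s, K (t - s) * F s ^ q := by
            rw [ENNReal.mul_rpow_of_nonneg _ _ hq0.le, ← ENNReal.rpow_mul, ← ENNReal.rpow_mul,
              one_div_mul_cancel hq0.ne', ENNReal.rpow_one, mul_comm]
            congr 2
            field_simp
    have hmeas : AEMeasurable (fun z : ℝ × ℝ => K (z.1 - z.2) * F z.2 ^ q)
        (volume.prod volume) := by
      refine AEMeasurable.mul ?_ ?_
      · exact hK.comp_quasiMeasurePreserving
          (quasiMeasurePreserving_sub (volume : Measure ℝ) volume)
      · exact (hF.pow_const q).comp_snd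
    have htot : ∫⁻ t, (∫⁻ s, K (t - s) * F s) ^ q ≤ A ^ q * ∫⁻ s, F s ^ q := by
      calc ∫⁻ t, (∫⁻ s, K (t - s) * F s) ^ q
          ≤ ∫⁻ t, A ^ (q - 1) * ∫⁻ s, K (t - s) * F s ^ q := lintegral_mono key
        _ = A ^ (q - 1) * ∫⁻ t, ∫⁻ s, K (t - s) * F s ^ q := by
            rw [lintegral_const_mul']
            exact ENNReal.rpow_ne_top_of_nonneg (by linarith) hKfin
        _ = A ^ (q - 1) * ∫⁻ s, ∫⁻ t, K (t - s) * F s ^ q := by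
            rw [lintegral_lintegral_swap hmeas]
        _ = A ^ (q - 1) * ∫⁻ s, A * F s ^ q := by
            congr 1
            refine lintegral_congr fun s => ?_
            rw [lintegral_mul_const'', lintegral_sub_right_eq_self]
            exact hK.comp_quasiMeasurePreserving
              (measurePreserving_sub_right volume s).quasiMeasurePreserving
        _ = A ^ q * ∫⁻ s, F s ^ q := by
            rw [lintegral_const_mul' _ _ hKfin, ← mul_assoc]
            congr 1
            conv_lhs => rw [← ENNReal.rpow_one A]
            rw [ENNReal.rpow_one A]
            nth_rewrite 2 [← ENNReal.rpow_one A]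
            rw [← ENNReal.rpow_add_of_nonneg _ _ (by linarith) zero_le_one]
            simp
    calc (∫⁻ t, (∫⁻ s, K (t - s) * F s) ^ q) ^ (1 / q)
        ≤ (A ^ q * ∫⁻ s, F s ^ q) ^ (1 / q) := by gcongr
      _ = A * (∫⁻ s, F s ^ q) ^ (1 / q) := by
          rw [ENNReal.mul_rpow_of_nonneg _ _ (by positivity), ← ENNReal.rpow_mul,
            mul_one_div_cancel hq0.ne', ENNReal.rpow_one]

variable (p : ℝ≥0∞)

/-- The convolution `∫ k(t - s) f(s) ds`. -/
def convFun (k f : ℝ → ℂ) (t : ℝ) : ℂ := ∫ s, k (t - s) * f s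

variable {p}

theorem lintegral_conv_eLpNorm_le (hp : 1 ≤ p) {k f : ℝ → ℂ} (hk : Integrable k)
    (hf : MemLp f p) :
    eLpNorm (fun t : ℝ => ∫⁻ s, ‖k (t - s) * f s‖ₑ) p volume
      ≤ ENNReal.ofReal (∫ s, ‖k s‖) * eLpNorm f p volume := by
  simp only [enorm_mul]
  have h := lintegral_young hp (K := fun s => ‖k s‖ₑ) (F := fun s => ‖f s‖ₑ)
    hk.aestronglyMeasurable.enorm hf.aestronglyMeasurable.enorm hk.hasFiniteIntegral.ne
  rw [ofReal_integral_norm_eq_lintegral_enorm hk]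
  exact h.trans (le_of_eq rfl)

theorem aestronglyMeasurable_integrand {k f : ℝ → ℂ} (hk : Integrable k)
    (hf : MemLp f p) :
    AEStronglyMeasurable (fun z : ℝ × ℝ => k (z.1 - z.2) * f z.2) (volume.prod volume) :=
  (hk.aestronglyMeasurable.comp_quasiMeasurePreserving
    (quasiMeasurePreserving_sub (volume : Measure ℝ) volume)).mul
    hf.aestronglyMeasurable.comp_snd

theorem ae_integrable_conv (hp : 1 ≤ p) {k f : ℝ → ℂ} (hk : Integrable k)
    (hf : MemLp f p) : ∀ᵐ t : ℝ, Integrable (fun s => k (t - s) * f s) := by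
  have hm := aestronglyMeasurable_integrand hk hf
  have hfin : MemLp (fun t : ℝ => ∫⁻ s, ‖k (t - s) * f s‖ₑ) p volume := by
    refine ⟨(hm.enorm.lintegral_prod_right').aestronglyMeasurable, ?_⟩
    exact (lintegral_conv_eLpNorm_le hp hk hf).trans_lt
      (ENNReal.mul_lt_top ENNReal.ofReal_lt_top hf.eLpNorm_lt_top)
  have h0 : p ≠ 0 := (zero_lt_one.trans_le hp).ne'
  have hae : ∀ᵐ t : ℝ, ∫⁻ s, ‖k (t - s) * f s‖ₑ < ∞ := by
    by_cases hptop : p = ∞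
    · have h1 := hfin.2
      rw [hptop, eLpNorm_exponent_top] at h1
      filter_upwards [ae_le_eLpNormEssSup (μ := volume)
        (f := fun t : ℝ => ∫⁻ s, ‖k (t - s) * f s‖ₑ)] with t ht
      simp only [enorm_eq_self] at ht
      exact ht.trans_lt h1
    · have h1 := lintegral_rpow_enorm_lt_top_of_eLpNorm_lt_top h0 hptop hfin.2
      simp only [enorm_eq_self] at h1
      have h2 := ae_lt_top' ((hm.enorm.lintegral_prod_right').pow_const p.toReal) h1.ne
      filter_upwards [h2] with t ht
      exact (ENNReal.rpow_lt_top_iff_of_pos (ENNReal.toReal_pos h0 hptop)).1 ht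
  filter_upwards [hae, hm.prodMk_left] with t ht hmt
  exact ⟨hmt, ht⟩

theorem eLpNorm_convFun_le (hp : 1 ≤ p) {k f : ℝ → ℂ} (hk : Integrable k)
    (hf : MemLp f p) :
    eLpNorm (convFun k f) p volume
      ≤ ENNReal.ofReal (∫ s, ‖k s‖) * eLpNorm f p volume := by
  refine le_trans (eLpNorm_mono_enorm fun t => ?_) (lintegral_conv_eLpNorm_le hp hk hf)
  simp only [enorm_eq_self]
  exact enorm_integral_le_lintegral_enorm _

theorem memLp_convFun (hp : 1 ≤ p) {k f : ℝ → ℂ} (hk : Integrable k)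
    (hf : MemLp f p) : MemLp (convFun k f) p :=
  ⟨(aestronglyMeasurable_integrand hk hf).integral_prod_right',
    (eLpNorm_convFun_le hp hk hf).trans_lt
      (ENNReal.mul_lt_top ENNReal.ofReal_lt_top hf.eLpNorm_lt_top)⟩

theorem convFun_congr {k f f' : ℝ → ℂ} (h : f =ᵐ[volume] f') : convFun k f = convFun k f' := by
  funext t
  refine integral_congr_ae ?_
  filter_upwards [h] with s hs
  rw [hs]

/-! ### Operators on `L^p(ℝ)` -/

variable (p) [Fact (1 ≤ p)]

/-- The complex space `L^p(ℝ)`. -/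
abbrev LpR : Type := Lp ℂ p (volume : Measure ℝ)

/-- Convolution with `k ∈ L¹(ℝ)` on `L^p(ℝ)`. -/
def convCLM (k : ℝ → ℂ) (hk : Integrable k) : LpR p →L[ℂ] LpR p :=
  LinearMap.mkContinuous
    { toFun := fun f => (memLp_convFun Fact.out hk (Lp.memLp f)).toLp (convFun k f)
      map_add' := fun f g => by
        rw [← MemLp.toLp_add]
        refine MemLp.toLp_congr _ _ ?_
        rw [convFun_congr (Lp.coeFn_add f g)]
        filter_upwards [ae_integrable_conv Fact.out hk (Lp.memLp f),
          ae_integrable_conv Fact.out hk (Lp.memLp g)] with t hf hg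
        simp only [convFun, Pi.add_apply, mul_add]
        exact integral_add hf hg
      map_smul' := fun c f => by
        rw [RingHom.id_apply, ← MemLp.toLp_const_smul]
        refine MemLp.toLp_congr _ _ ?_
        rw [convFun_congr (Lp.coeFn_smul c f)]
        refine Filter.Eventually.of_forall fun t => ?_
        simp only [convFun, Pi.smul_apply, smul_eq_mul]
        rw [← integral_const_mul]
        congr 1
        funext s
        ring }
    (∫ s, ‖k s‖) (fun f => by
      simp only [LinearMap.coe_mk, AddHom.coe_mk, Lp.norm_toLp]
      rw [Lp.norm_def]
      have h := ENNReal.toReal_mono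
        (ENNReal.mul_lt_top ENNReal.ofReal_lt_top (Lp.eLpNorm_lt_top f)).ne
        (eLpNorm_convFun_le (Fact.out : 1 ≤ p) hk (Lp.memLp f))
      rwa [ENNReal.toReal_mul, ENNReal.toReal_ofReal (by positivity)] at h)

/-- The translation `f ↦ f(· - δ)` on `L^p(ℝ)`. -/
def translate (δ : ℝ) : LpR p →L[ℂ] LpR p :=
  (Lp.compMeasurePreservingₗᵢ ℂ (fun t : ℝ => t - δ)
    (measurePreserving_sub_right volume δ)).toContinuousLinearMap

/-- The reflection `f ↦ f(c - ·)` on `L^p(ℝ)`. -/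
def reflectAt (c : ℝ) : LpR p →L[ℂ] LpR p :=
  (Lp.compMeasurePreservingₗᵢ ℂ (fun t : ℝ => c - t)
    (Measure.measurePreserving_sub_left volume c)).toContinuousLinearMap

/-- The operator `(J f)(t) = f(-t)` on `L^p(ℝ)`. -/
def J : LpR p →L[ℂ] LpR p :=
  (Lp.compMeasurePreservingₗᵢ ℂ (fun t : ℝ => -t)
    (Measure.measurePreserving_neg volume)).toContinuousLinearMap

set_option linter.unusedSectionVars false in
variable {p} in
theorem norm_indicator_toLp_le {s : Set ℝ} (hs : MeasurableSet s) (f : LpR p) :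
    ‖((Lp.memLp f).indicator hs).toLp (s.indicator f)‖ ≤ 1 * ‖f‖ := by
  rw [one_mul, Lp.norm_toLp, Lp.norm_def]
  exact ENNReal.toReal_mono (Lp.eLpNorm_lt_top f).ne (eLpNorm_indicator_le _)

/-- Multiplication by the characteristic function `χ_s` on `L^p(ℝ)`. -/
def cut (s : Set ℝ) (hs : MeasurableSet s) : LpR p →L[ℂ] LpR p :=
  LinearMap.mkContinuous
    { toFun := fun f => ((Lp.memLp f).indicator hs).toLp (s.indicator f)
      map_add' := fun f g => by
        rw [← MemLp.toLp_add]
        refine MemLp.toLp_congr _ _ ?_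
        filter_upwards [Lp.coeFn_add f g] with t ht
        by_cases h : t ∈ s
        · simpa only [Set.indicator_of_mem h, Pi.add_apply] using ht
        · simp [h]
      map_smul' := fun c f => by
        rw [RingHom.id_apply, ← MemLp.toLp_const_smul]
        refine MemLp.toLp_congr _ _ ?_
        filter_upwards [Lp.coeFn_smul c f] with t ht
        by_cases h : t ∈ s
        · simpa only [Set.indicator_of_mem h, Pi.smul_apply] using ht
        · simp [h] }
    1 (norm_indicator_toLp_le hs)

variable {p} in
theorem coeFn_cut (s : Set ℝ) (hs : MeasurableSet s) (f : LpR p) :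
    (cut p s hs f : LpR p) =ᵐ[volume] s.indicator f := by
  have h : cut p s hs f = ((Lp.memLp f).indicator hs).toLp (s.indicator f) := by
    rw [cut, LinearMap.mkContinuous_apply]
    rfl
  rw [h]
  exact MemLp.coeFn_toLp _

/-- The projection `P f = χ_{ℝ⁺} f`. -/
def P : LpR p →L[ℂ] LpR p := cut p (Set.Ioi 0) measurableSet_Ioi

/-- The complementary projection `Q = I - P`. -/
def Q : LpR p →L[ℂ] LpR p := ContinuousLinearMap.id ℂ (LpR p) - P p

/-- `L^p(ℝ⁺)`, the subspace of `L^p(ℝ)` of the functions that vanish on `ℝ⁻`. -/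
def LpPlus : Submodule ℂ (LpR p) where
  carrier := {f | ∀ᵐ t : ℝ, t < 0 → f t = 0}
  zero_mem' := by
    filter_upwards [Lp.coeFn_zero ℂ p (volume : Measure ℝ)] with t ht _
    exact ht
  add_mem' := fun {f g} hf hg => by
    filter_upwards [hf, hg, Lp.coeFn_add f g] with t h1 h2 h3 h
    rw [h3, Pi.add_apply, h1 h, h2 h, add_zero]
  smul_mem' := fun c f hf => by
    filter_upwards [hf, Lp.coeFn_smul c f] with t h1 h2 h
    rw [h2, Pi.smul_apply, h1 h, smul_zero]

variable {p} in
theorem cut_mem_LpPlus {s : Set ℝ} (hs : MeasurableSet s) (hs' : s ⊆ Set.Ioi 0) (f : LpR p) :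
    cut p s hs f ∈ LpPlus p := by
  filter_upwards [coeFn_cut s hs f] with t ht h
  rw [ht, Set.indicator_of_notMem]
  exact fun hmem => absurd (hs' hmem) (not_lt.2 h.le)

variable {p} in
theorem J_Q_mem_LpPlus (f : LpR p) : J p (Q p f) ∈ LpPlus p := by
  have h1 : (J p (Q p f) : LpR p) =ᵐ[volume] (Q p f : LpR p) ∘ (fun t : ℝ => -t) :=
    Lp.coeFn_compMeasurePreserving (Q p f) (Measure.measurePreserving_neg volume)
  have h2 : (Q p f : LpR p) =ᵐ[volume] f - (P p f : LpR p) := Lp.coeFn_sub f (P p f)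
  have h3 := (Measure.measurePreserving_neg
    (volume : Measure ℝ)).quasiMeasurePreserving.ae (h2.and (coeFn_cut (Set.Ioi 0) measurableSet_Ioi f))
  filter_upwards [h1, h3] with t ht h3 h
  rw [ht, Function.comp_apply, h3.1, Pi.sub_apply, P, h3.2,
    Set.indicator_of_mem (by simpa using h), sub_self]

/-! ### The algebra `G` of symbols and the operators generated by them -/

/-- A representation
`a(t) = ∑_j a_j e^{i δ_j t} + ∫ k(s) e^{its} ds` with pairwise distinct `δ_j`,
`∑_j |a_j| < ∞` and `k ∈ L¹(ℝ)`. The pairs `(a_j, δ_j)` with `a_j ≠ 0`, and the class of `k` in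
`L¹(ℝ)`, are determined by the function `a`. -/
structure Rep (a : ℝ → ℂ) where
  coeff : ℤ → ℂ
  freq : ℤ → ℝ
  kernel : ℝ → ℂ
  freq_injective : Function.Injective freq
  summable_coeff : Summable fun j => ‖coeff j‖
  integrable_kernel : Integrable kernel
  eq : ∀ t : ℝ, a t = (∑' j, coeff j * Complex.exp (Complex.I * freq j * t))
    + ∫ s : ℝ, kernel s * Complex.exp (Complex.I * t * s)

/-- The set `G` of symbols. -/
def G : Set (ℝ → ℂ) := {a | Nonempty (Rep a)}

/-- The set `G⁺` of the symbols with non-negative frequencies and a kernel that vanishes on the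
negative semi-axis. -/
def GPlus : Set (ℝ → ℂ) :=
  {a | ∃ r : Rep a, (∀ j, 0 ≤ r.freq j) ∧ ∀ᵐ s : ℝ, s < 0 → r.kernel s = 0}

/-- The operator `f ↦ ∑_j a_j f(· - δ_j) + ∫ k(· - s) f(s) ds` on `L^p(ℝ)`; the series converges
absolutely in the operator norm, because translations are isometries. -/
def Rep.op {a : ℝ → ℂ} (r : Rep a) : LpR p →L[ℂ] LpR p :=
  (∑' j, r.coeff j • translate p (r.freq j)) + convCLM p r.kernel r.integrable_kernel

open Classical in
/-- The convolution operator `W⁰(a)` on `L^p(ℝ)` generated by `a ∈ G`, formed with a representation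
of `a` (and `0` if `a ∉ G`). As the representation of `a` is unique up to the order of the terms
and terms with coefficient `0`, the operator does not depend on the choice. -/
def W0 (a : ℝ → ℂ) : LpR p →L[ℂ] LpR p :=
  if h : a ∈ G then (Classical.choice h).op p else 0

/-- The Wiener–Hopf operator `W(a) = P W⁰(a)` on `L^p(ℝ⁺)`. -/
def W (a : ℝ → ℂ) : LpPlus p →L[ℂ] LpPlus p :=
  ((P p ∘L W0 p a) ∘L (LpPlus p).subtypeL).codRestrict (LpPlus p)
    (fun _ => cut_mem_LpPlus measurableSet_Ioi subset_rfl _)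

/-- The kernel of `W(a)`. -/
abbrev kerW (a : ℝ → ℂ) : Submodule ℂ (LpPlus p) := LinearMap.ker (W p a).toLinearMap

/-- The operator `J Q W⁰(a) P` as an operator on `L^p(ℝ⁺)`. -/
def JQWP (a : ℝ → ℂ) : LpPlus p →L[ℂ] LpPlus p :=
  ((J p ∘L Q p ∘L W0 p a ∘L P p) ∘L (LpPlus p).subtypeL).codRestrict (LpPlus p)
    (fun _ => J_Q_mem_LpPlus _)

/-- The operator **P**`(g) = J Q W⁰(g) P` restricted to `ker W(g)`. -/
def PP (g : ℝ → ℂ) : kerW p g →L[ℂ] LpPlus p := JQWP p g ∘L (kerW p g).subtypeL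

/-- **P**`⁺(g) = (I + `**P**`(g)) / 2` on `ker W(g)`. -/
def PPplus (g : ℝ → ℂ) : kerW p g →L[ℂ] LpPlus p :=
  (1 / 2 : ℂ) • ((kerW p g).subtypeL + PP p g)

/-- **P**`⁻(g) = (I - `**P**`(g)) / 2` on `ker W(g)`. -/
def PPminus (g : ℝ → ℂ) : kerW p g →L[ℂ] LpPlus p :=
  (1 / 2 : ℂ) • ((kerW p g).subtypeL - PP p g)

/-- The operator `R_c` on `L^p(ℝ⁺)`: `(R_c f)(t) = f(c - t)` for `0 < t < c` and
`(R_c f)(t) = 0` for `t > c`. -/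
def R (c : ℝ) : LpPlus p →L[ℂ] LpPlus p :=
  ((cut p (Set.Ioo 0 c) measurableSet_Ioo ∘L reflectAt p c) ∘L (LpPlus p).subtypeL).codRestrict
    (LpPlus p) (fun _ => cut_mem_LpPlus measurableSet_Ioo Set.Ioo_subset_Ioi_self _)

/-- A matching function: `g ∈ G` and `g(t) g(-t) = 1`. -/
def IsMatching (g : ℝ → ℂ) : Prop := g ∈ G ∧ ∀ t : ℝ, g t * g (-t) = 1

/-- The function `(t - i) / (t + i)`. -/
def cayley (t : ℝ) : ℂ := (t - Complex.I) / (t + Complex.I)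

/-- `σ(g) = (-1)^n g(0)`. -/
def sigma (g : ℝ → ℂ) (n : ℕ) : ℂ := (-1) ^ n * g 0

/-- The functions `φ ∈ L^p(ℝ⁺)` with `φ(t) = 0` for `t > c` and
`∫_0^∞ φ(t) t^j e^{-t} dt = 0` for `j = 0, …, n - 1`. -/
def Admissible (c : ℝ) (n : ℕ) (φ : LpPlus p) : Prop :=
  (∀ᵐ t : ℝ, c < t → (φ : LpR p) t = 0) ∧
    ∀ j < n, ∫ t in Set.Ioi (0 : ℝ), (φ : LpR p) t * (t : ℂ) ^ j * (Real.exp (-t) : ℂ) = 0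

end WienerHopf

end

noncomputable section

namespace WienerHopf

/-! Write `C` for convolution with symbol `(t - i)/(t + i)` and `τ` for translation by `ν`. Since
`W⁰` is multiplicative, the factorization of `g` gives `W⁰(g) = σ · J W⁰(g₊⁻¹) J · τ · C^n ·
W⁰(g₊)`. Given `h` in `L^p(ℝ⁺)`, put `φ = C^n W⁰(g₊) h`, again in `L^p(ℝ⁺)`. Then `P W⁰(g) h = 0`
says that `J W⁰(g) h = σ W⁰(g₊⁻¹) J τ φ` lies in `L^p(ℝ⁺)`. As `W⁰(g₊⁻¹)` and its inverse `W⁰(g₊)`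
preserve this space, the condition is `J τ φ ∈ L^p(ℝ⁺)`, that is, `φ = 0` beyond `|ν|`.

Conversely, `φ` comes from some `h` in `L^p(ℝ⁺)` iff `C⁻ⁿ φ ∈ L^p(ℝ⁺)`. On the negative axis `C⁻¹ f`
is a multiple of `e^t ∫ f(s) e^{-s} ds`, and iterating this yields exactly the `n` moment conditions
(`cayleyInvOp_pow_mem_LpPlus_iff`). The formula for `J Q W⁰(g) P h` follows, because `(J τ φ)(t) =
φ(|ν| - t)`.

Multiplicativity of `W⁰` has to hold for every `p`, including `p = ∞`, where Schwartz functions are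
not dense. It is therefore proved by duality (`HasSymbol`): `T` has symbol `a` if moving `T` to the
other side of a pairing with the transform of `w` replaces `w` by `a w`. Such operators compose like
their symbols and are determined by them (`HasSymbol.comp`, `HasSymbol.unique`). This also makes
`W⁰(a)` independent of the chosen representation. -/

variable {p : ℝ≥0∞} [Fact (1 ≤ p)]

/-! ### Pairing with bounded integrable functions -/

/-- Integrable and bounded functions. They lie in every `L^q`. -/
structure IsBddIntegrable (ψ : ℝ → ℂ) : Prop where
  integrable : Integrable ψ
  bounded : ∃ C : ℝ, ∀ t, ‖ψ t‖ ≤ C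

/-- For finite `q`, the bound `|ψ|^q ≤ C^(q-1) |ψ|` reduces the claim to integrability. -/
theorem IsBddIntegrable.memLp {ψ : ℝ → ℂ} (h : IsBddIntegrable ψ) {q : ℝ≥0∞} (hq : 1 ≤ q) :
    MemLp ψ q := by
  obtain ⟨C, hC⟩ := h.bounded
  have htop : MemLp ψ ∞ := memLp_top_of_bound h.integrable.1 C (.of_forall hC)
  by_cases hq' : q = ∞
  · rwa [hq']
  refine ⟨h.integrable.1, ?_⟩
  have hq0 : q ≠ 0 := (zero_lt_one.trans_le hq).ne'
  have hr : 1 ≤ q.toReal := by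
    have := (ENNReal.toReal_le_toReal ENNReal.one_ne_top hq').2 hq
    simpa using this
  rw [eLpNorm_lt_top_iff_lintegral_rpow_enorm_lt_top hq0 hq']
  have hb : ∀ t, ‖ψ t‖ₑ ^ q.toReal ≤ ENNReal.ofReal C ^ (q.toReal - 1) * ‖ψ t‖ₑ := by
    intro t
    have h1 : ‖ψ t‖ₑ ≤ ENNReal.ofReal C := by
      rw [← ofReal_norm]
      exact ENNReal.ofReal_le_ofReal (hC t)
    calc ‖ψ t‖ₑ ^ q.toReal = ‖ψ t‖ₑ ^ (q.toReal - 1 + 1) := by ring_nf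
      _ = ‖ψ t‖ₑ ^ (q.toReal - 1) * ‖ψ t‖ₑ := by
        rw [ENNReal.rpow_add_of_nonneg _ _ (by linarith) zero_le_one, ENNReal.rpow_one]
      _ ≤ _ := by gcongr
  refine (lintegral_mono hb).trans_lt ?_
  rw [lintegral_const_mul' _ _ (ENNReal.rpow_ne_top_of_nonneg (by linarith) ENNReal.ofReal_ne_top)]
  exact ENNReal.mul_lt_top
    (ENNReal.rpow_lt_top_of_nonneg (by linarith) ENNReal.ofReal_ne_top) h.integrable.2

instance : Fact (1 ≤ ENNReal.conjExponent p) :=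
  ⟨ENNReal.HolderConjugate.one_le (ENNReal.conjExponent p) p⟩

theorem IsBddIntegrable.memLp_conj {ψ : ℝ → ℂ} (h : IsBddIntegrable ψ) :
    MemLp ψ (ENNReal.conjExponent p) :=
  h.memLp Fact.out

theorem IsBddIntegrable.integrable_mul {ψ f : ℝ → ℂ} (h : IsBddIntegrable ψ) (hf : MemLp f p) :
    Integrable (fun t => f t * ψ t) :=
  memLp_one_iff_integrable.1 (MemLp.mul' (h.memLp_conj (p := p)) hf)

variable (p) in
/-- The functional `f ↦ ∫ f ψ` on `L^p(ℝ)`. -/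
def IsBddIntegrable.functional {ψ : ℝ → ℂ} (h : IsBddIntegrable ψ) : LpR p →L[ℂ] ℂ :=
  ((ContinuousLinearMap.mul ℂ ℂ).lpPairing volume p (ENNReal.conjExponent p)).flip
    (h.memLp_conj.toLp ψ)

theorem IsBddIntegrable.functional_apply {ψ : ℝ → ℂ} (h : IsBddIntegrable ψ) (f : LpR p) :
    h.functional p f = ∫ t, f t * ψ t := by
  rw [functional, ContinuousLinearMap.flip_apply, ContinuousLinearMap.lpPairing_eq_integral]
  refine integral_congr_ae ?_
  filter_upwards [(h.memLp_conj (p := p)).coeFn_toLp] with t ht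
  simp [ht]

theorem coeFn_convCLM (k : ℝ → ℂ) (hk : Integrable k) (f : LpR p) :
    (convCLM p k hk f : LpR p) =ᵐ[volume] convFun k f := by
  have h : convCLM p k hk f = (memLp_convFun Fact.out hk (Lp.memLp f)).toLp (convFun k f) := by
    rw [convCLM, LinearMap.mkContinuous_apply]
    rfl
  rw [h]
  exact MemLp.coeFn_toLp _

theorem coeFn_translate (δ : ℝ) (f : LpR p) :
    (translate p δ f : LpR p) =ᵐ[volume] fun t => f (t - δ) :=
  Lp.coeFn_compMeasurePreserving f (measurePreserving_sub_right volume δ)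

theorem coeFn_reflectAt (c : ℝ) (f : LpR p) :
    (reflectAt p c f : LpR p) =ᵐ[volume] fun t => f (c - t) :=
  Lp.coeFn_compMeasurePreserving f (Measure.measurePreserving_sub_left volume c)

theorem coeFn_J (f : LpR p) : (J p f : LpR p) =ᵐ[volume] fun t => f (-t) :=
  Lp.coeFn_compMeasurePreserving f (Measure.measurePreserving_neg volume)

/-- The convolution with a reflected kernel. -/
def corrFun (k ψ : ℝ → ℂ) (s : ℝ) : ℂ := ∫ t, k (t - s) * ψ t

/-- Fubini. The double integral converges absolutely because Young's inequality puts `|k| * |f|` in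
`L^p`, and Hölder pairs this with `|ψ|`. -/
theorem integral_convFun_mul {k f ψ : ℝ → ℂ} (hk : Integrable k) (hf : MemLp f p)
    (hψ : IsBddIntegrable ψ) :
    ∫ t, convFun k f t * ψ t = ∫ s, f s * corrFun k ψ s := by
  have hm := aestronglyMeasurable_integrand hk hf
  have hint : Integrable (Function.uncurry fun t s : ℝ => k (t - s) * f s * ψ t)
      (volume.prod volume) := by
    refine (integrable_prod_iff (hm.mul hψ.integrable.1.comp_fst)).2 ⟨?_, ?_⟩
    · filter_upwards [ae_integrable_conv Fact.out hk hf] with t ht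
      exact ht.mul_const (ψ t)
    · have h1 : MemLp (convFun (fun s => (‖k s‖ : ℂ)) (fun s => (‖f s‖ : ℂ))) p :=
        memLp_convFun Fact.out hk.norm.ofReal hf.norm.ofReal
      refine (hψ.integrable_mul h1).norm.congr (.of_forall fun t => ?_)
      have h2 : convFun (fun s => (‖k s‖ : ℂ)) (fun s => (‖f s‖ : ℂ)) t
          = ((∫ s, ‖k (t - s)‖ * ‖f s‖ : ℝ) : ℂ) := by
        rw [convFun, ← integral_complex_ofReal]
        push_cast
        rfl
      simp only [h2, norm_mul, Complex.norm_real, Pi.mul_apply, integral_mul_const]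
      rw [Real.norm_of_nonneg (by positivity)]
  calc ∫ t, convFun k f t * ψ t = ∫ t, ∫ s, k (t - s) * f s * ψ t := by
        simp only [convFun, integral_mul_const]
    _ = ∫ s, ∫ t, k (t - s) * f s * ψ t := integral_integral_swap hint
    _ = _ := by
        congr 1
        funext s
        rw [corrFun, ← integral_const_mul]
        congr 1
        funext t
        ring

/-! ### The Fourier transform with the normalisation of the symbols -/

/-- The function `t ↦ ∫ w(s) e^{its} ds`. -/
def phi (w : ℝ → ℂ) (t : ℝ) : ℂ := ∫ s : ℝ, w s * Complex.exp (Complex.I * t * s)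

theorem norm_exp_I_mul (t s : ℝ) : ‖Complex.exp (Complex.I * t * s)‖ = 1 := by
  rw [mul_assoc, mul_comm, ← Complex.ofReal_mul, Complex.norm_exp_ofReal_mul_I]

theorem phi_eq_fourier (w : ℝ → ℂ) (t : ℝ) :
    phi w t = FourierTransform.fourier w (-t / (2 * Real.pi)) := by
  rw [Real.fourier_real_eq_integral_exp_smul, phi]
  refine integral_congr_ae (.of_forall fun s => ?_)
  simp only [smul_eq_mul]
  rw [mul_comm]
  congr 2
  have : (Real.pi : ℂ) ≠ 0 := by exact_mod_cast Real.pi_ne_zero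
  push_cast
  field_simp

theorem continuous_exp_I_mul (t : ℝ) : Continuous fun s : ℝ => Complex.exp (Complex.I * t * s) := by
  fun_prop

theorem integrable_mul_exp {w : ℝ → ℂ} (hw : Integrable w) (t : ℝ) :
    Integrable fun s : ℝ => w s * Complex.exp (Complex.I * t * s) :=
  hw.mul_bdd (c := 1) (continuous_exp_I_mul t).aestronglyMeasurable
    (.of_forall fun s => (norm_exp_I_mul t s).le)

theorem norm_phi_le (w : ℝ → ℂ) (t : ℝ) : ‖phi w t‖ ≤ ∫ s, ‖w s‖ := by
  refine (norm_integral_le_integral_norm _).trans_eq ?_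
  simp only [norm_mul, norm_exp_I_mul, mul_one]

theorem continuous_phi {w : ℝ → ℂ} (hw : Integrable w) : Continuous (phi w) := by
  refine continuous_of_dominated (bound := fun s => ‖w s‖)
    (fun t => (integrable_mul_exp hw t).1) (fun t => .of_forall fun s => ?_) hw.norm
    (.of_forall fun s => by fun_prop)
  rw [norm_mul, norm_exp_I_mul, mul_one]

theorem phi_add {v w : ℝ → ℂ} (hv : Integrable v) (hw : Integrable w) (t : ℝ) :
    phi (fun s => v s + w s) t = phi v t + phi w t := by
  simp only [phi, add_mul]
  exact integral_add (integrable_mul_exp hv t) (integrable_mul_exp hw t)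

theorem phi_const_mul (c : ℂ) (w : ℝ → ℂ) (t : ℝ) :
    phi (fun s => c * w s) t = c * phi w t := by
  simp only [phi, mul_assoc]
  exact integral_const_mul _ _

theorem phi_exp_mul (w : ℝ → ℂ) (δ t : ℝ) :
    phi (fun s => Complex.exp (Complex.I * δ * s) * w s) t = phi w (t + δ) := by
  refine integral_congr_ae (.of_forall fun s => ?_)
  simp only
  push_cast
  rw [mul_add, add_mul, Complex.exp_add]
  ring

theorem phi_comp_neg (w : ℝ → ℂ) (t : ℝ) : phi (fun s => w (-s)) t = phi w (-t) := by
  rw [phi, phi, ← integral_neg_eq_self]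
  refine integral_congr_ae (.of_forall fun s => ?_)
  simp

/-- Functions `w` for which `w` and its Fourier transform are integrable. -/
structure IsTest (w : ℝ → ℂ) : Prop where
  integrable : Integrable w
  integrable_phi : Integrable (phi w)

theorem IsTest.isBddIntegrable {w : ℝ → ℂ} (h : IsTest w) : IsBddIntegrable (phi w) :=
  ⟨h.integrable_phi, _, norm_phi_le w⟩

/-- The rescaling `y ↦ u(-2πy)` absorbs the change of normalisation between `phi` and the Fourier
transform; `w` is the inverse transform of this Schwartz function. -/
theorem exists_isTest_of_contDiff {u : ℝ → ℝ} (hu : ContDiff ℝ (⊤ : ℕ∞) u)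
    (hc : HasCompactSupport u) :
    ∃ w, IsTest w ∧ ∀ t, phi w t = u t := by
  have hpi : (2 * Real.pi) ≠ 0 := by positivity
  let v : ℝ → ℂ := fun y => (u (-(2 * Real.pi) * y) : ℂ)
  have hv : ContDiff ℝ (⊤ : ℕ∞) v := Complex.ofRealCLM.contDiff.comp
    (hu.comp (contDiff_const.mul contDiff_id))
  have hvc : HasCompactSupport v := by
    have h1 : HasCompactSupport (fun y => u (-(2 * Real.pi) * y)) :=
      hc.comp_homeomorph (Homeomorph.mulLeft₀ (-(2 * Real.pi)) (neg_ne_zero.2 hpi))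
    exact h1.comp_left (g := fun x : ℝ => (x : ℂ)) Complex.ofReal_zero
  let V := hvc.toSchwartzMap hv
  have key : ∀ t, phi (FourierTransform.fourierInv V) t = u t := fun t => by
    rw [phi_eq_fourier, ← SchwartzMap.fourier_coe, FourierTransform.fourier_fourierInv_eq]
    change ((u (-(2 * Real.pi) * (-t / (2 * Real.pi))) : ℝ) : ℂ) = u t
    congr 2
    field_simp
  refine ⟨FourierTransform.fourierInv V, ⟨SchwartzMap.integrable _, ?_⟩, key⟩
  rw [funext key]
  exact (hu.continuous.integrable_of_hasCompactSupport hc).ofReal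

/-! ### Operators with a symbol -/

/-- The operator `T` acts on `L^p(ℝ)` as the Fourier multiplier `a`, tested by duality. -/
def HasSymbol (T : LpR p →L[ℂ] LpR p) (a : ℝ → ℂ) : Prop :=
  ∀ w, IsTest w → IsTest (fun x => a x * w x) ∧
    ∀ f : LpR p, ∫ t, T f t * phi w t = ∫ t, f t * phi (fun x => a x * w x) t

namespace HasSymbol

variable {T S : LpR p →L[ℂ] LpR p} {a b : ℝ → ℂ}

/-- Every smooth compactly supported function is the transform of some test `w`, and integrals
against such functions determine a locally integrable function. -/
theorem unique (hT : HasSymbol T a) (hS : HasSymbol S a) : T = S := by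
  ext1 f
  refine Lp.ext ?_
  refine ae_eq_of_integral_contDiff_smul_eq ((Lp.memLp (T f)).locallyIntegrable Fact.out)
    ((Lp.memLp (S f)).locallyIntegrable Fact.out) fun u hu hc => ?_
  obtain ⟨w, hw, hwu⟩ := exists_isTest_of_contDiff hu hc
  have h := ((hT w hw).2 f).trans ((hS w hw).2 f).symm
  simpa only [hwu, Complex.real_smul, mul_comm] using h

/-- This is where `HasSymbol` needs tests to be stable under the symbol: the test `a w` produced by
`T` is handed on to `S`. -/
theorem comp (hT : HasSymbol T a) (hS : HasSymbol S b) :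
    HasSymbol (T ∘L S) (fun x => a x * b x) := by
  intro w hw
  obtain ⟨h1, h2⟩ := hT w hw
  obtain ⟨h3, h4⟩ := hS _ h1
  have e : (fun x => a x * b x * w x) = fun x => b x * (a x * w x) := by
    funext x; ring
  rw [e]
  exact ⟨h3, fun f => (h2 (S f)).trans (h4 f)⟩

theorem add (hT : HasSymbol T a) (hS : HasSymbol S b) :
    HasSymbol (T + S) (fun x => a x + b x) := by
  intro w hw
  obtain ⟨h1, h2⟩ := hT w hw
  obtain ⟨h3, h4⟩ := hS w hw
  have e : (fun x => (a x + b x) * w x) = fun x => a x * w x + b x * w x := by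
    funext x; ring
  have e' : phi (fun x => a x * w x + b x * w x)
      = fun t => phi (fun x => a x * w x) t + phi (fun x => b x * w x) t :=
    funext fun t => phi_add h1.integrable h3.integrable t
  rw [e, e']
  refine ⟨⟨h1.integrable.add h3.integrable, ?_⟩, fun f => ?_⟩
  · rw [e']
    exact h1.integrable_phi.add h3.integrable_phi
  · simp only [mul_add]
    rw [integral_add (h1.isBddIntegrable.integrable_mul (Lp.memLp f))
      (h3.isBddIntegrable.integrable_mul (Lp.memLp f)), ← h2, ← h4,
      ← hw.isBddIntegrable.functional_apply, ← hw.isBddIntegrable.functional_apply,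
      ← hw.isBddIntegrable.functional_apply, _root_.add_apply, map_add]

theorem smul (c : ℂ) (hT : HasSymbol T a) : HasSymbol (c • T) (fun x => c * a x) := by
  intro w hw
  obtain ⟨h1, h2⟩ := hT w hw
  have e : (fun x => c * a x * w x) = fun x => c * (a x * w x) := by
    funext x; ring
  have e' := funext fun t => phi_const_mul c (fun x => a x * w x) t
  rw [e, e']
  refine ⟨⟨h1.integrable.const_mul c, ?_⟩, fun f => ?_⟩
  · rw [e']
    exact h1.integrable_phi.const_mul c
  · simp only [mul_left_comm _ c]
    rw [integral_const_mul, ← h2, ← hw.isBddIntegrable.functional_apply,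
      ← hw.isBddIntegrable.functional_apply, _root_.smul_apply, map_smul,
      smul_eq_mul]

theorem id : HasSymbol (ContinuousLinearMap.id ℂ (LpR p)) (fun _ => 1) := by
  intro w hw
  simp only [one_mul]
  exact ⟨hw, fun f => rfl⟩

theorem pow (hT : HasSymbol T a) (n : ℕ) : HasSymbol (T ^ n) (fun x => a x ^ n) := by
  induction n with
  | zero =>
    simp only [pow_zero]
    exact id
  | succ n ih =>
    simp only [pow_succ]
    exact ih.comp hT

theorem translate (δ : ℝ) :
    HasSymbol (translate p δ) (fun x => Complex.exp (Complex.I * δ * x)) := by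
  intro w hw
  have e := funext fun t => phi_exp_mul w δ t
  refine ⟨⟨?_, ?_⟩, fun f => ?_⟩
  · simpa only [mul_comm] using integrable_mul_exp hw.integrable δ
  · rw [e]
    exact hw.integrable_phi.comp_add_right δ
  · rw [e, ← integral_sub_right_eq_self (fun t => f t * phi w (t + δ)) δ]
    refine integral_congr_ae ?_
    filter_upwards [coeFn_translate δ f] with t ht
    rw [ht, sub_add_cancel]

theorem J_comp_J (hT : HasSymbol T a) :
    HasSymbol (J p ∘L T ∘L J p) (fun x => a (-x)) := by
  intro w hw
  have hw' : IsTest fun x => w (-x) := by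
    refine ⟨hw.integrable.comp_neg, ?_⟩
    rw [funext fun t => phi_comp_neg w t]
    exact hw.integrable_phi.comp_neg
  obtain ⟨h1, h2⟩ := hT _ hw'
  have e : (fun x => a (-x) * w x) = fun x => (fun y => a y * w (-y)) (-x) := by
    funext x; simp
  have e' := funext fun t => phi_comp_neg (fun y => a y * w (-y)) t
  rw [e, e']
  refine ⟨⟨h1.integrable.comp_neg, ?_⟩, fun f => ?_⟩
  · rw [e']
    exact h1.integrable_phi.comp_neg
  · have h3 := h2 (J p f)
    calc ∫ t, (J p (T (J p f)) : LpR p) t * phi w t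
        = ∫ t, (T (J p f) : LpR p) (-t) * phi w (- -t) := by
          refine integral_congr_ae ?_
          filter_upwards [coeFn_J (T (J p f))] with t ht
          rw [ht, neg_neg]
      _ = ∫ t, (T (J p f) : LpR p) t * phi w (-t) :=
          integral_neg_eq_self (fun t => (T (J p f) : LpR p) t * phi w (-t)) volume
      _ = ∫ t, (J p f : LpR p) t * phi (fun x => a x * w (-x)) t := by
          simpa only [phi_comp_neg] using h3
      _ = ∫ t, f (-t) * phi (fun x => a x * w (-x)) (- -t) := by
          refine integral_congr_ae ?_
          filter_upwards [coeFn_J f] with t ht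
          rw [ht, neg_neg]
      _ = _ := integral_neg_eq_self (fun t => f t * phi (fun x => a x * w (-x)) (-t)) volume

/-- By Fubini the transform of `phi k * w` is the correlation of `k` with `phi w`, and correlation
is the transpose of convolution. Young's inequality for `L¹` makes it integrable. -/
theorem convCLM {k : ℝ → ℂ} (hk : Integrable k) : HasSymbol (convCLM p k hk) (phi k) := by
  intro w hw
  have e : phi (fun x => phi k x * w x) = corrFun k (phi w) := by
    funext s
    have hint : Integrable (Function.uncurry fun x u : ℝ =>
        w x * k u * Complex.exp (Complex.I * (s + u) * x)) (volume.prod volume) := by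
      refine (hw.integrable.mul_prod hk).mul_bdd (c := 1)
        (Continuous.aestronglyMeasurable (by fun_prop)) (.of_forall fun z => ?_)
      have := norm_exp_I_mul (s + z.2) z.1
      push_cast at this
      exact this.le
    calc phi (fun x => phi k x * w x) s
        = ∫ x, ∫ u, w x * k u * Complex.exp (Complex.I * (s + u) * x) := by
          refine integral_congr_ae (.of_forall fun x => ?_)
          simp only
          rw [mul_assoc, mul_comm, phi, ← integral_const_mul]
          refine integral_congr_ae (.of_forall fun u => ?_)
          simp only
          rw [mul_add, add_mul, Complex.exp_add, mul_right_comm Complex.I (x : ℂ)]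
          ring
      _ = ∫ u, ∫ x, w x * k u * Complex.exp (Complex.I * (s + u) * x) :=
          integral_integral_swap hint
      _ = ∫ u, k u * phi w (u + s) := by
          refine integral_congr_ae (.of_forall fun u => ?_)
          simp only [phi]
          rw [← integral_const_mul]
          refine integral_congr_ae (.of_forall fun x => ?_)
          simp only
          push_cast
          rw [add_comm (u : ℂ)]
          ring
      _ = corrFun k (phi w) s := by
          rw [corrFun, ← integral_sub_right_eq_self _ s]
          simp only [sub_add_cancel]
  refine ⟨⟨?_, ?_⟩, fun f => ?_⟩
  · exact hw.integrable.bdd_mul (continuous_phi hk).aestronglyMeasurable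
      (.of_forall (norm_phi_le k))
  · have e2 : corrFun k (phi w) = convFun (fun u => k (-u)) (phi w) := by
      funext s
      simp only [corrFun, convFun, neg_sub]
    rw [e, e2]
    exact memLp_one_iff_integrable.1
      (memLp_convFun le_rfl hk.comp_neg (memLp_one_iff_integrable.2 hw.integrable_phi))
  · rw [e, ← integral_convFun_mul hk (Lp.memLp f) hw.isBddIntegrable]
    refine integral_congr_ae ?_
    filter_upwards [coeFn_convCLM k hk f] with t ht
    rw [ht]

end HasSymbol

/-! ### Absolutely convergent sums of translations -/

theorem norm_translate_apply (δ : ℝ) (f : LpR p) : ‖translate p δ f‖ = ‖f‖ :=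
  LinearIsometry.norm_map _ f

theorem summable_smul_translate {c : ℤ → ℂ} (hc : Summable fun j => ‖c j‖) (δ : ℤ → ℝ) :
    Summable fun j => c j • translate p (δ j) := by
  refine Summable.of_norm_bounded hc fun j => ?_
  rw [norm_smul]
  refine mul_le_of_le_one_right (norm_nonneg _) ?_
  exact ContinuousLinearMap.opNorm_le_bound _ zero_le_one fun f => by
    rw [norm_translate_apply, one_mul]

/-- An absolutely convergent sum of exponentials. -/
def expSum (c : ℤ → ℂ) (δ : ℤ → ℝ) (t : ℝ) : ℂ :=
  ∑' j, c j * Complex.exp (Complex.I * δ j * t)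

theorem norm_mul_exp (c : ℤ → ℂ) (δ : ℤ → ℝ) (j : ℤ) (t : ℝ) :
    ‖c j * Complex.exp (Complex.I * δ j * t)‖ = ‖c j‖ := by
  rw [norm_mul, norm_exp_I_mul, mul_one]

theorem norm_expSum_le {c : ℤ → ℂ} (hc : Summable fun j => ‖c j‖) (δ : ℤ → ℝ) (t : ℝ) :
    ‖expSum c δ t‖ ≤ ∑' j, ‖c j‖ :=
  tsum_of_norm_bounded hc.hasSum fun j => (norm_mul_exp c δ j t).le

theorem continuous_expSum {c : ℤ → ℂ} (hc : Summable fun j => ‖c j‖) (δ : ℤ → ℝ) :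
    Continuous (expSum c δ) :=
  continuous_tsum (fun j => by fun_prop) hc fun j t => (norm_mul_exp c δ j t).le

theorem phi_expSum_mul {c : ℤ → ℂ} (hc : Summable fun j => ‖c j‖) (δ : ℤ → ℝ) {w : ℝ → ℂ}
    (hw : Integrable w) (s : ℝ) :
    phi (fun x => expSum c δ x * w x) s = ∑' j, c j * phi w (s + δ j) := by
  let F : ℤ → ℝ → ℂ := fun j x =>
    c j * (Complex.exp (Complex.I * δ j * x) * w x * Complex.exp (Complex.I * s * x))
  have hF : ∀ j, Integrable (F j) := fun j => by
    refine Integrable.const_mul (integrable_mul_exp ?_ s) _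
    simpa only [mul_comm] using integrable_mul_exp hw (δ j)
  have hn : ∀ j, ∫ x, ‖F j x‖ = ‖c j‖ * ∫ x, ‖w x‖ := fun j => by
    simp only [F, norm_mul, norm_exp_I_mul, mul_one, one_mul]
    exact integral_const_mul _ _
  have h := (hasSum_integral_of_summable_integral_norm hF
    (by simpa only [hn] using hc.mul_right _)).tsum_eq
  have hj : ∀ j, ∫ x, F j x = c j * phi w (s + δ j) := fun j => by
    rw [← phi_exp_mul w (δ j) s, phi, ← integral_const_mul]
  simp only [hj] at h
  rw [h, phi]
  refine integral_congr_ae (.of_forall fun x => ?_)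
  simp only [expSum, F]
  rw [mul_assoc, ← tsum_mul_right]
  refine tsum_congr fun j => ?_
  ring

theorem integrable_tsum_mul_shift {c : ℤ → ℂ} (hc : Summable fun j => ‖c j‖) (δ : ℤ → ℝ)
    {ψ : ℝ → ℂ} (hψ : Integrable ψ)
    (hm : AEStronglyMeasurable (fun s => ∑' j, c j * ψ (s + δ j)) volume) :
    Integrable fun s => ∑' j, c j * ψ (s + δ j) := by
  refine ⟨hm, ?_⟩
  rw [hasFiniteIntegral_iff_enorm]
  have hψ' : ∀ j, AEStronglyMeasurable (fun s => ψ (s + δ j)) volume := fun j =>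
    (hψ.comp_add_right (δ j)).1
  calc ∫⁻ s, ‖∑' j, c j * ψ (s + δ j)‖ₑ
      ≤ ∫⁻ s, ∑' j, ‖c j * ψ (s + δ j)‖ₑ := lintegral_mono fun s => enorm_tsum_le_tsum_enorm
    _ = ∑' j, ∫⁻ s, ‖c j * ψ (s + δ j)‖ₑ :=
        lintegral_tsum fun j => ((hψ' j).const_mul (c j)).enorm
    _ = ∑' j, ‖c j‖ₑ * ∫⁻ s, ‖ψ s‖ₑ := by
        refine tsum_congr fun j => ?_
        simp only [enorm_mul]
        rw [lintegral_const_mul' _ _ enorm_ne_top,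
          lintegral_add_right_eq_self (fun s => ‖ψ s‖ₑ) (δ j)]
    _ = (∑' j, ‖c j‖ₑ) * ∫⁻ s, ‖ψ s‖ₑ := ENNReal.tsum_mul_right
    _ < ∞ := by
        refine ENNReal.mul_lt_top ?_ hψ.2
        have h1 := ENNReal.ofReal_tsum_of_nonneg (fun j => norm_nonneg (c j)) hc
        simp only [ofReal_norm] at h1
        rw [← h1]
        exact ENNReal.ofReal_lt_top

/-- The integral pairs a translate of `|f|` with `|ψ|`, and translations are isometries, so the
bound is uniform in `δ`. It justifies exchanging sum and integral in `HasSymbol.tsum_translate`. -/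
theorem exists_integral_norm_mul_shift_le {ψ : ℝ → ℂ} (hψ : IsBddIntegrable ψ) (f : LpR p) :
    ∃ C, ∀ δ, ∫ s, ‖f s‖ * ‖ψ (s + δ)‖ ≤ C := by
  have hψn : IsBddIntegrable (fun s => (‖ψ s‖ : ℂ)) := by
    obtain ⟨C, hC⟩ := hψ.bounded
    exact ⟨hψ.integrable.norm.ofReal, C, fun t => by simpa using hC t⟩
  let F : LpR p := (Lp.memLp f).norm.ofReal.toLp (fun s => (‖f s‖ : ℂ))
  refine ⟨‖hψn.functional p‖ * ‖F‖, fun δ => ?_⟩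
  have h1 := (hψn.functional p).le_opNorm (translate p δ F)
  rw [norm_translate_apply, hψn.functional_apply] at h1
  refine le_trans (le_of_eq ?_) h1
  have h2 : ∫ t, (translate p δ F : LpR p) t * (‖ψ t‖ : ℂ)
      = ((∫ s, ‖f s‖ * ‖ψ (s + δ)‖ : ℝ) : ℂ) := by
    rw [← integral_complex_ofReal,
      ← integral_sub_right_eq_self (fun s => ((‖f s‖ * ‖ψ (s + δ)‖ : ℝ) : ℂ)) δ]
    refine integral_congr_ae ?_
    have h3 := (measurePreserving_sub_right (volume : Measure ℝ) δ).quasiMeasurePreserving.ae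
      ((Lp.memLp f).norm.ofReal (K := ℂ)).coeFn_toLp
    filter_upwards [coeFn_translate δ F, h3] with t h4 h5
    rw [h4, show F (t - δ) = (‖f (t - δ)‖ : ℂ) from h5, sub_add_cancel]
    push_cast
    rfl
  rw [h2, Complex.norm_real, Real.norm_of_nonneg (by positivity)]

namespace HasSymbol

theorem tsum_translate {c : ℤ → ℂ} (hc : Summable fun j => ‖c j‖) (δ : ℤ → ℝ) :
    HasSymbol (∑' j, c j • WienerHopf.translate p (δ j)) (expSum c δ) := by
  intro w hw
  have e := funext fun s => phi_expSum_mul hc δ hw.integrable s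
  have hi : Integrable fun x => expSum c δ x * w x :=
    hw.integrable.bdd_mul (continuous_expSum hc δ).aestronglyMeasurable
      (.of_forall (norm_expSum_le hc δ))
  refine ⟨⟨hi, ?_⟩, fun f => ?_⟩
  · rw [e]
    refine integrable_tsum_mul_shift hc δ hw.integrable_phi ?_
    rw [← e]
    exact (continuous_phi hi).aestronglyMeasurable
  · have hs := summable_smul_translate (p := p) hc δ
    have hψ := hw.isBddIntegrable
    rw [← hψ.functional_apply]
    -- The pairing is a continuous functional, so it passes through the series, which converges in
    -- operator norm.
    have h1 : (hψ.functional p) ((∑' j, c j • WienerHopf.translate p (δ j)) f)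
        = ∑' j, c j * ∫ s, f s * phi w (s + δ j) := by
      rw [← ContinuousLinearMap.apply_apply (𝕜 := ℂ) f, ContinuousLinearMap.map_tsum _ hs,
        ContinuousLinearMap.map_tsum _ ((ContinuousLinearMap.apply ℂ (LpR p) f).summable hs)]
      refine tsum_congr fun j => ?_
      rw [ContinuousLinearMap.apply_apply, _root_.smul_apply, map_smul, smul_eq_mul,
        hψ.functional_apply, ((HasSymbol.translate (p := p) (δ j)) w hw).2 f]
      simp only [phi_exp_mul]
    obtain ⟨C, hC⟩ := exists_integral_norm_mul_shift_le hψ f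
    have hF : ∀ j, Integrable fun s => c j * (f s * phi w (s + δ j)) := fun j => by
      refine Integrable.const_mul ?_ _
      have h := (((HasSymbol.translate (p := p) (δ j)) w hw).1.isBddIntegrable).integrable_mul
        (Lp.memLp f)
      simpa only [phi_exp_mul] using h
    have h2 := (hasSum_integral_of_summable_integral_norm hF ?_).tsum_eq
    · simp only [integral_const_mul] at h2
      rw [h1, h2, e]
      refine integral_congr_ae (.of_forall fun s => ?_)
      simp only
      rw [← tsum_mul_left]
      exact tsum_congr fun j => by ring
    · refine Summable.of_nonneg_of_le (fun j => by positivity) (fun j => ?_) (hc.mul_right C)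
      simp only [norm_mul]
      rw [integral_const_mul]
      exact mul_le_mul_of_nonneg_left (hC (δ j)) (norm_nonneg _)

end HasSymbol

theorem Rep.hasSymbol {a : ℝ → ℂ} (r : Rep a) : HasSymbol (r.op p) a := by
  have h := (HasSymbol.tsum_translate (p := p) r.summable_coeff r.freq).add
    (HasSymbol.convCLM r.integrable_kernel)
  have e : a = fun x => expSum r.coeff r.freq x + phi r.kernel x := funext r.eq
  rw [Rep.op]
  convert h using 1

theorem hasSymbol_W0 {a : ℝ → ℂ} (h : a ∈ G) : HasSymbol (W0 p a) a := by
  rw [W0, dif_pos h]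
  exact Rep.hasSymbol _

/-- Both operators have symbol `a`. Hence the arbitrary choice in `W0` is harmless, and the
representation witnessing membership in `GPlus` may be used. -/
theorem W0_eq_op {a : ℝ → ℂ} (r : Rep a) : W0 p a = r.op p :=
  (hasSymbol_W0 ⟨r⟩).unique r.hasSymbol

/-! ### Supports -/

theorem coeFn_P (f : LpR p) : (P p f : LpR p) =ᵐ[volume] (Set.Ioi (0 : ℝ)).indicator f :=
  coeFn_cut _ _ f

theorem ae_ne_zero : ∀ᵐ t : ℝ, t ≠ 0 := by
  simp [ae_iff]

theorem P_eq_self_iff {f : LpR p} : P p f = f ↔ f ∈ LpPlus p := by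
  constructor
  · intro h
    rw [← h]
    exact cut_mem_LpPlus measurableSet_Ioi subset_rfl f
  · intro h
    refine Lp.ext ?_
    filter_upwards [coeFn_P f, h, ae_ne_zero] with t h1 h2 h3
    rw [h1, Set.indicator_apply]
    split_ifs with h4
    · rfl
    · exact (h2 (lt_of_le_of_ne (not_lt.1 h4) h3)).symm

theorem P_eq_zero_iff {f : LpR p} : P p f = 0 ↔ ∀ᵐ t : ℝ, 0 < t → f t = 0 := by
  rw [← sub_eq_zero, sub_zero, Lp.eq_zero_iff_ae_eq_zero]
  constructor
  · intro h
    filter_upwards [h, coeFn_P f] with t h1 h2 h3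
    rw [h2, Set.indicator_of_mem (Set.mem_Ioi.2 h3)] at h1
    exact h1
  · intro h
    filter_upwards [h, coeFn_P f] with t h1 h2
    rw [h2]
    exact Set.indicator_apply_eq_zero.2 h1

theorem J_J (f : LpR p) : J p (J p f) = f := by
  refine Lp.ext ?_
  filter_upwards [coeFn_J (J p f),
    (Measure.measurePreserving_neg (volume : Measure ℝ)).quasiMeasurePreserving.ae (coeFn_J f)]
    with t h1 h2
  rw [h1, h2, neg_neg]

theorem J_mem_LpPlus_iff {f : LpR p} : J p f ∈ LpPlus p ↔ P p f = 0 := by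
  rw [P_eq_zero_iff]
  constructor
  · intro (h : ∀ᵐ t : ℝ, t < 0 → (J p f : LpR p) t = 0)
    filter_upwards [(Measure.measurePreserving_neg (volume : Measure ℝ)).quasiMeasurePreserving.ae
      (h.and (coeFn_J f))] with t h1 h2
    have h3 := h1.1 (by linarith)
    rwa [h1.2, neg_neg] at h3
  · intro h
    filter_upwards [(Measure.measurePreserving_neg (volume : Measure ℝ)).quasiMeasurePreserving.ae h,
      coeFn_J f] with t h1 h2 h3
    rw [h2]
    exact h1 (by linarith)

theorem translate_mem_LpPlus {δ : ℝ} (hδ : 0 ≤ δ) {f : LpR p} (hf : f ∈ LpPlus p) :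
    translate p δ f ∈ LpPlus p := by
  filter_upwards [coeFn_translate δ f,
    (measurePreserving_sub_right (volume : Measure ℝ) δ).quasiMeasurePreserving.ae hf]
    with t h1 h2 h3
  rw [h1]
  exact h2 (by linarith)

theorem convCLM_mem_LpPlus {k : ℝ → ℂ} (hk : Integrable k) (hk0 : ∀ᵐ s : ℝ, s < 0 → k s = 0)
    {f : LpR p} (hf : f ∈ LpPlus p) : convCLM p k hk f ∈ LpPlus p := by
  filter_upwards [coeFn_convCLM k hk f] with t h1 h2
  rw [h1, convFun]
  refine integral_eq_zero_of_ae ?_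
  filter_upwards [hf,
    (Measure.measurePreserving_sub_left (volume : Measure ℝ) t).quasiMeasurePreserving.ae hk0]
    with s h3 h4
  rcases lt_or_ge s 0 with h | h
  · rw [h3 h, mul_zero, Pi.zero_apply]
  · rw [h4 (by linarith), zero_mul, Pi.zero_apply]

/-- `L^p(ℝ⁺)` is the fixed space of the continuous map `P`, so it suffices to treat the series term
by term. -/
theorem Rep.op_mem_LpPlus {a : ℝ → ℂ} (r : Rep a) (hfreq : ∀ j, 0 ≤ r.freq j)
    (hker : ∀ᵐ s : ℝ, s < 0 → r.kernel s = 0) {f : LpR p} (hf : f ∈ LpPlus p) :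
    r.op p f ∈ LpPlus p := by
  have hs := summable_smul_translate (p := p) r.summable_coeff r.freq
  rw [Rep.op, _root_.add_apply]
  refine add_mem ?_ (convCLM_mem_LpPlus r.integrable_kernel hker hf)
  have hs' := (ContinuousLinearMap.apply ℂ (LpR p) f).summable hs
  rw [← P_eq_self_iff, ← ContinuousLinearMap.apply_apply (𝕜 := ℂ) f,
    ContinuousLinearMap.map_tsum _ hs, ContinuousLinearMap.map_tsum _ hs']
  refine tsum_congr fun j => ?_
  exact P_eq_self_iff.2 (Submodule.smul_mem _ _ (translate_mem_LpPlus (hfreq j) hf))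

theorem W0_mem_LpPlus {a : ℝ → ℂ} (ha : a ∈ GPlus) {f : LpR p} (hf : f ∈ LpPlus p) :
    W0 p a f ∈ LpPlus p := by
  obtain ⟨r, h1, h2⟩ := ha
  rw [W0_eq_op r]
  exact r.op_mem_LpPlus h1 h2 hf

theorem GPlus_subset_G : GPlus ⊆ G := fun _ ⟨r, _⟩ => ⟨r⟩

theorem coe_W (a : ℝ → ℂ) (f : LpPlus p) : (W p a f : LpR p) = P p (W0 p a f) := rfl

theorem coe_W_of_mem {a : ℝ → ℂ} {f : LpPlus p} (h : W0 p a f ∈ LpPlus p) :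
    (W p a f : LpR p) = W0 p a f := P_eq_self_iff.2 h

/-! ### The Cayley function -/

/-- The kernel `e^{-s}` on the positive semi-axis. -/
def expKernel (s : ℝ) : ℂ := (Set.Ioi (0 : ℝ)).indicator (fun s => (Real.exp (-s) : ℂ)) s

theorem integrable_expKernel : Integrable expKernel := by
  refine (integrable_indicator_iff measurableSet_Ioi).2 ?_
  exact (integrableOn_exp_neg_Ioi 0).ofReal

theorem phi_expKernel (t : ℝ) : phi expKernel t = (1 - Complex.I * t)⁻¹ := by
  have h := integral_exp_mul_complex_Ioi (a := Complex.I * t - 1) (by simp) 0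
  have e : phi expKernel t
      = ∫ s in Set.Ioi (0 : ℝ), Complex.exp ((Complex.I * t - 1) * s) := by
    rw [phi, ← integral_indicator measurableSet_Ioi]
    refine integral_congr_ae (.of_forall fun s => ?_)
    by_cases hs : s ∈ Set.Ioi (0 : ℝ)
    · simp only [expKernel, Set.indicator_of_mem hs]
      rw [Complex.ofReal_exp, ← Complex.exp_add]
      congr 1
      push_cast
      ring
    · simp [expKernel, Set.indicator_of_notMem hs]
  rw [e, h]
  simp only [Complex.ofReal_zero, mul_zero, Complex.exp_zero]
  rw [neg_div, ← div_neg, neg_sub, one_div]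

theorem one_sub_I_mul_ne_zero (t : ℝ) : (1 - Complex.I * t : ℂ) ≠ 0 := fun h => by
  simpa using congrArg Complex.re h

theorem add_I_ne_zero (t : ℝ) : (t + Complex.I : ℂ) ≠ 0 := fun h => by
  simpa using congrArg Complex.im h

theorem sub_I_ne_zero (t : ℝ) : (t - Complex.I : ℂ) ≠ 0 := fun h => by
  simpa using congrArg Complex.im h

theorem cayley_ne_zero (t : ℝ) : cayley t ≠ 0 := div_ne_zero (sub_I_ne_zero t) (add_I_ne_zero t)

theorem inv_cayley (t : ℝ) : (cayley t)⁻¹ = cayley (-t) := by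
  have h1 := add_I_ne_zero t
  have h2 := sub_I_ne_zero t
  have h3 : (-t + Complex.I : ℂ) ≠ 0 := by
    rw [← neg_ne_zero]; convert h2 using 1; ring
  rw [cayley, cayley, inv_div]
  push_cast
  rw [div_eq_div_iff h2 h3]
  ring

theorem cayley_eq (t : ℝ) : cayley t = 1 + -2 * phi expKernel t := by
  have h1 := one_sub_I_mul_ne_zero t
  have h2 := add_I_ne_zero t
  have h3 : (t + Complex.I : ℂ) = Complex.I * (1 - Complex.I * t) := by
    linear_combination (t : ℂ) * Complex.I_sq
  have h4 := inv_mul_cancel₀ h1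
  rw [phi_expKernel, cayley, div_eq_iff h2, h3]
  linear_combination 2 * Complex.I * h4 + (t : ℂ) * Complex.I_sq

theorem inv_cayley_eq (t : ℝ) : (cayley t)⁻¹ = 1 + phi (fun s => -2 * expKernel (-s)) t := by
  rw [inv_cayley, cayley_eq, phi_const_mul, phi_comp_neg]

/-- `W⁰((t - i)/(t + i))`. -/
def cayleyOp (p : ℝ≥0∞) [Fact (1 ≤ p)] : LpR p →L[ℂ] LpR p :=
  ContinuousLinearMap.id ℂ (LpR p) + (-2 : ℂ) • convCLM p expKernel integrable_expKernel

/-- `W⁰((t + i)/(t - i))`. -/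
def cayleyInvOp (p : ℝ≥0∞) [Fact (1 ≤ p)] : LpR p →L[ℂ] LpR p :=
  ContinuousLinearMap.id ℂ (LpR p) + convCLM p _ (integrable_expKernel.comp_neg.const_mul (-2))

theorem hasSymbol_cayleyOp : HasSymbol (cayleyOp p) cayley := by
  rw [funext cayley_eq]
  exact HasSymbol.id.add ((HasSymbol.convCLM integrable_expKernel).smul (-2))

theorem hasSymbol_cayleyInvOp : HasSymbol (cayleyInvOp p) (fun t => (cayley t)⁻¹) := by
  rw [funext inv_cayley_eq]
  exact HasSymbol.id.add (HasSymbol.convCLM _)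

theorem cayleyOp_mem_LpPlus {f : LpR p} (hf : f ∈ LpPlus p) : cayleyOp p f ∈ LpPlus p := by
  refine add_mem hf (Submodule.smul_mem _ _ (convCLM_mem_LpPlus _ (.of_forall fun s hs => ?_) hf))
  exact Set.indicator_of_notMem (fun h => lt_asymm hs h) _

theorem cayleyOp_pow_mem_LpPlus {f : LpR p} (hf : f ∈ LpPlus p) (n : ℕ) :
    (cayleyOp p ^ n) f ∈ LpPlus p := by
  induction n with
  | zero => exact hf
  | succ n ih =>
    rw [pow_succ']
    exact cayleyOp_mem_LpPlus (f := (cayleyOp p ^ n) f) ih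

theorem cayleyOp_pow_cayleyInvOp_pow (n : ℕ) (f : LpR p) :
    (cayleyOp p ^ n) ((cayleyInvOp p ^ n) f) = f := by
  have h := ((hasSymbol_cayleyOp (p := p)).pow n).comp (hasSymbol_cayleyInvOp.pow n)
  have e : (fun t => cayley t ^ n * (cayley t)⁻¹ ^ n) = fun _ => 1 := by
    funext t
    rw [← mul_pow, mul_inv_cancel₀ (cayley_ne_zero t), one_pow]
  rw [e] at h
  exact DFunLike.congr_fun (h.unique .id) f

theorem cayleyInvOp_pow_cayleyOp_pow (n : ℕ) (f : LpR p) :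
    (cayleyInvOp p ^ n) ((cayleyOp p ^ n) f) = f := by
  have h := ((hasSymbol_cayleyInvOp (p := p)).pow n).comp (hasSymbol_cayleyOp.pow n)
  have e : (fun t => (cayley t)⁻¹ ^ n * cayley t ^ n) = fun _ => 1 := by
    funext t
    rw [← mul_pow, inv_mul_cancel₀ (cayley_ne_zero t), one_pow]
  rw [e] at h
  exact DFunLike.congr_fun (h.unique .id) f

/-! ### Powers of the inverse Cayley function as symbols in `G` -/

theorem mem_G_of_eq_one_add_phi {a k : ℝ → ℂ} (hk : Integrable k) (h : ∀ t, a t = 1 + phi k t) :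
    a ∈ G := by
  -- Only the frequency `0` carries a coefficient; the others are filled in by the integers because
  -- `Rep` wants all frequencies distinct, even those with coefficient `0`.
  refine ⟨{ coeff := Pi.single 0 1, freq := fun j => j, kernel := k,
            freq_injective := Int.cast_injective, summable_coeff := ?_, integrable_kernel := hk,
            eq := fun t => ?_ }⟩
  · refine summable_of_ne_finset_zero (s := {0}) fun j hj => ?_
    rw [Pi.single_eq_of_ne (by simpa using hj), norm_zero]
  · rw [tsum_eq_single 0 fun j hj => by rw [Pi.single_eq_of_ne hj, zero_mul], h, phi]
    simp

open scoped Convolution in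
theorem exists_phi_mul {k l : ℝ → ℂ} (hk : Integrable k) (hl : Integrable l) :
    ∃ m, Integrable m ∧ ∀ t, phi m t = phi k t * phi l t := by
  refine ⟨k ⋆[ContinuousLinearMap.mul ℂ ℂ, volume] l, hk.integrable_convolution _ hl, fun t => ?_⟩
  rw [phi_eq_fourier, Real.fourier_mul_convolution_eq hk hl, phi_eq_fourier, phi_eq_fourier]

theorem exists_inv_cayley_pow_eq (n : ℕ) :
    ∃ k, Integrable k ∧ ∀ t, (cayley t)⁻¹ ^ n = 1 + phi k t := by
  induction n with
  | zero => exact ⟨fun _ => 0, integrable_zero _ _ _, fun t => by simp [phi]⟩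
  | succ n ih =>
    obtain ⟨k, hk, hk'⟩ := ih
    have hl := integrable_expKernel.comp_neg.const_mul (-2)
    obtain ⟨m, hm, hm'⟩ := exists_phi_mul hk hl
    have hlm : Integrable fun s => -2 * expKernel (-s) + m s := hl.add hm
    refine ⟨fun s => k s + (-2 * expKernel (-s) + m s), hk.add hlm, fun t => ?_⟩
    rw [phi_add hk hlm, phi_add hl hm, hm', pow_succ, hk', inv_cayley_eq]
    ring

theorem cayley_zpow_neg_mem_G (n : ℕ) : (fun t => cayley t ^ (-(n : ℤ))) ∈ G := by
  obtain ⟨k, hk, h⟩ := exists_inv_cayley_pow_eq n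
  exact mem_G_of_eq_one_add_phi hk fun t => by rw [zpow_neg, zpow_natCast, ← inv_pow, h]

theorem W0_cayley_zpow_neg (n : ℕ) :
    W0 p (fun t => cayley t ^ (-(n : ℤ))) = cayleyInvOp p ^ n := by
  refine (hasSymbol_W0 (cayley_zpow_neg_mem_G n)).unique ?_
  have h := (hasSymbol_cayleyInvOp (p := p)).pow n
  simpa only [zpow_neg, zpow_natCast, inv_pow] using h

/-! ### Exponentially weighted moments -/

/-- The weight `t^j e^{-t}` on the positive semi-axis. -/
def weight (j : ℕ) : ℝ → ℂ :=
  (Set.Ioi (0 : ℝ)).indicator fun t => (t : ℂ) ^ j * (Real.exp (-t) : ℂ)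

theorem isBddIntegrable_weight (j : ℕ) : IsBddIntegrable (weight j) := by
  refine ⟨(integrable_indicator_iff measurableSet_Ioi).2 ?_, j.factorial, fun t => ?_⟩
  · have h := (Real.GammaIntegral_convergent (s := j + 1) (by positivity)).ofReal (𝕜 := ℂ)
    refine h.congr ?_
    filter_upwards [self_mem_ae_restrict measurableSet_Ioi] with t ht
    rw [add_sub_cancel_right, Real.rpow_natCast]
    simp only [Complex.coe_algebraMap, RCLike.ofReal_mul, RCLike.ofReal_pow, mul_comm]
  · by_cases ht : t ∈ Set.Ioi (0 : ℝ)
    · have ht' : 0 < t := ht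
      rw [weight, Set.indicator_of_mem ht, norm_mul, norm_pow, Complex.norm_real,
        Complex.norm_real, Real.norm_of_nonneg ht'.le, Real.norm_of_nonneg (Real.exp_pos _).le,
        Real.exp_neg, ← div_eq_mul_inv, div_le_iff₀ (Real.exp_pos _)]
      have := Real.pow_div_factorial_le_exp t ht'.le j
      rwa [div_le_iff₀ (by positivity), mul_comm] at this
    · rw [weight, Set.indicator_of_notMem ht, norm_zero]
      positivity

/-- The moment `∫_0^∞ f(t) t^j e^{-t} dt`. -/
def moment (j : ℕ) (f : LpR p) : ℂ := ∫ t, f t * weight j t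

set_option linter.unusedSectionVars false in
theorem setIntegral_eq_moment (j : ℕ) (f : LpR p) :
    ∫ t in Set.Ioi (0 : ℝ), f t * (t : ℂ) ^ j * (Real.exp (-t) : ℂ) = moment j f := by
  rw [moment, ← integral_indicator measurableSet_Ioi]
  refine integral_congr_ae (.of_forall fun t => ?_)
  simp only [weight, Set.indicator_apply]
  split_ifs
  · ring
  · rw [mul_zero]

/-- On `0 < t < s` the product `e^{t-s} · t^j e^{-t}` equals `e^{-s} t^j`, leaving only the integral
of `t^j` over `(0, s)`. -/
theorem corrFun_expKernel_weight (j : ℕ) (s : ℝ) :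
    corrFun (fun u => -2 * expKernel (-u)) (weight j) s = -2 / (j + 1) * weight (j + 1) s := by
  have e : corrFun (fun u => -2 * expKernel (-u)) (weight j) s
      = ∫ t in Set.Ioo 0 s, -2 * (Real.exp (-s) : ℂ) * (t : ℂ) ^ j := by
    rw [corrFun, ← integral_indicator measurableSet_Ioo]
    refine integral_congr_ae (.of_forall fun t => ?_)
    simp only [expKernel, weight, Set.indicator_apply, Set.mem_Ioi, Set.mem_Ioo, neg_sub, sub_pos]
    by_cases h1 : 0 < t <;> by_cases h2 : t < s <;> simp only [h1, h2, and_self, and_true,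
      and_false, if_true, if_false, mul_zero, zero_mul]
    have h3 : (Real.exp (-s) : ℂ) = (Real.exp (t - s) : ℂ) * (Real.exp (-t) : ℂ) := by
      rw [← Complex.ofReal_mul, ← Real.exp_add]
      ring_nf
    rw [h3]
    ring
  have hj : ((j : ℂ) + 1) ≠ 0 := Nat.cast_add_one_ne_zero j
  rw [e, integral_const_mul]
  rcases lt_or_ge 0 s with hs | hs
  · have h : ∫ t in Set.Ioo 0 s, (t : ℂ) ^ j = (s : ℂ) ^ (j + 1) / (j + 1) := by
      rw [← integral_Ioc_eq_integral_Ioo, ← intervalIntegral.integral_of_le hs.le]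
      have h1 := integral_pow (a := 0) (b := s) j
      have h2 : ∫ t in (0 : ℝ)..s, (t : ℂ) ^ j = ((∫ t in (0 : ℝ)..s, t ^ j : ℝ) : ℂ) := by
        rw [← intervalIntegral.integral_ofReal]
        simp
      rw [h2, h1]
      simp
    rw [h, weight, Set.indicator_of_mem (Set.mem_Ioi.2 hs)]
    field_simp
  · rw [Set.Ioo_eq_empty (not_lt.2 hs), weight,
      Set.indicator_of_notMem (show s ∉ Set.Ioi 0 from not_lt.2 hs)]
    simp

/-- `C⁻¹` turns the `j`-th moment into a combination of the `j`-th and the next one, which drives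
the induction on the exponent of `C⁻¹`. -/
theorem moment_cayleyInvOp (j : ℕ) (f : LpR p) :
    moment j (cayleyInvOp p f) = moment j f + -2 / (j + 1) * moment (j + 1) f := by
  have hk := integrable_expKernel.comp_neg.const_mul (-2)
  have hw := isBddIntegrable_weight j
  have h1 : moment j (cayleyInvOp p f) = moment j f + moment j (convCLM p _ hk f) := by
    simp only [moment]
    rw [← hw.functional_apply, ← hw.functional_apply, ← hw.functional_apply, cayleyInvOp,
      _root_.add_apply, map_add]
    rfl
  have h2 : moment j (convCLM p _ hk f)
      = ∫ t, convFun (fun u => -2 * expKernel (-u)) f t * weight j t := by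
    refine integral_congr_ae ?_
    filter_upwards [coeFn_convCLM _ hk f] with t ht
    rw [ht]
  rw [h1, h2, integral_convFun_mul hk (Lp.memLp f) hw]
  simp only [corrFun_expKernel_weight, mul_left_comm _ (-2 / ((j : ℂ) + 1))]
  rw [integral_const_mul, moment, moment]

set_option linter.unusedSectionVars false in
-- For `t < 0 < s` the cutoff in the kernel is inactive and `e^{t-s}` splits into a product.
theorem convFun_of_neg {f : LpR p} (hf : f ∈ LpPlus p) {t : ℝ} (ht : t < 0) :
    convFun (fun u => -2 * expKernel (-u)) f t = -2 * (Real.exp t : ℂ) * moment 0 f := by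
  rw [convFun, moment, ← integral_const_mul]
  refine integral_congr_ae ?_
  filter_upwards [hf, ae_ne_zero] with s h1 h2
  rcases lt_or_gt_of_ne h2 with h | h
  · rw [h1 h]
    ring
  · have h3 : t < s := ht.trans h
    have h4 : (Real.exp (t - s) : ℂ) = (Real.exp t : ℂ) * (Real.exp (-s) : ℂ) := by
      rw [← Complex.ofReal_mul, ← Real.exp_add]
      ring_nf
    simp only [expKernel, weight, Set.indicator_apply, Set.mem_Ioi, neg_sub, sub_pos, h, h3,
      if_true, h4]
    ring

theorem cayleyInvOp_mem_LpPlus_iff {f : LpR p} (hf : f ∈ LpPlus p) :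
    cayleyInvOp p f ∈ LpPlus p ↔ moment 0 f = 0 := by
  have hk := integrable_expKernel.comp_neg.const_mul (-2)
  have h1 : cayleyInvOp p f ∈ LpPlus p ↔ convCLM p _ hk f ∈ LpPlus p :=
    (LpPlus p).add_mem_iff_right hf
  rw [h1]
  constructor
  · intro (h : ∀ᵐ t : ℝ, t < 0 → (convCLM p _ hk f : LpR p) t = 0)
    have h2 : ∀ᵐ t : ℝ, t < 0 → moment 0 f = 0 := by
      filter_upwards [h, coeFn_convCLM _ hk f] with t h3 h4 h5
      have h6 := h3 h5
      rw [h4, convFun_of_neg hf h5] at h6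
      simpa using h6
    -- The conclusion of `h2` does not depend on `t`; if it failed, the negative half-line would be
    -- a null set.
    by_contra hne
    have h3 : volume (Set.Iio (0 : ℝ)) = 0 := by
      refine measure_mono_null (fun t ht => ?_) (ae_iff.1 h2)
      exact fun h4 => hne (h4 ht)
    simp at h3
  · intro h
    filter_upwards [coeFn_convCLM _ hk f] with t h4 h5
    rw [h4, convFun_of_neg hf h5, h, mul_zero]

theorem cayleyInvOp_pow_mem_LpPlus_iff (n : ℕ) {f : LpR p} (hf : f ∈ LpPlus p) :
    (cayleyInvOp p ^ n) f ∈ LpPlus p ↔ ∀ j < n, moment j f = 0 := by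
  induction n generalizing f with
  | zero => simpa using hf
  | succ n ih =>
    have e : (cayleyInvOp p ^ (n + 1)) f = (cayleyInvOp p ^ n) (cayleyInvOp p f) := by
      rw [pow_succ]
      rfl
    rw [e]
    constructor
    · intro h
      -- Applying `C^n` to `C⁻ⁿ⁻¹ f` shows that already `C⁻¹ f` lies in `L^p(ℝ⁺)`, so the induction
      -- hypothesis applies to it.
      have h1 := cayleyOp_pow_mem_LpPlus h n
      rw [cayleyOp_pow_cayleyInvOp_pow] at h1
      have h2 := (ih h1).1 h
      intro j hj
      cases j with
      | zero => exact (cayleyInvOp_mem_LpPlus_iff hf).1 h1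
      | succ j =>
        -- Climb the recursion: when moment `i` of both `f` and `C⁻¹ f` vanishes, so does moment `i
        -- + 1` of `f`, its factor `-2/(i+1)` being nonzero.
        have hind : ∀ i ≤ n, moment i f = 0 := by
          intro i
          induction i with
          | zero => exact fun _ => (cayleyInvOp_mem_LpPlus_iff hf).1 h1
          | succ i ihi =>
            intro hi
            have h3 := h2 i hi
            rw [moment_cayleyInvOp, ihi (by omega), zero_add, mul_eq_zero] at h3
            refine h3.resolve_left (div_ne_zero (by norm_num) (Nat.cast_add_one_ne_zero i))
        exact hind _ (by omega)
    · intro h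
      refine (ih ((cayleyInvOp_mem_LpPlus_iff hf).2 (h 0 (by omega)))).2 fun j hj => ?_
      rw [moment_cayleyInvOp, h j (by omega), h (j + 1) (by omega), mul_zero, add_zero]

theorem admissible_iff {c : ℝ} {n : ℕ} {φ : LpPlus p} :
    Admissible p c n φ ↔ (∀ᵐ t : ℝ, c < t → (φ : LpR p) t = 0) ∧
      (cayleyInvOp p ^ n) (φ : LpR p) ∈ LpPlus p := by
  rw [cayleyInvOp_pow_mem_LpPlus_iff n φ.2, Admissible]
  simp only [setIntegral_eq_moment]

/-! ### The kernel of `W(g)` -/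

theorem P_translate_eq_zero_iff {ν : ℝ} (f : LpR p) :
    P p (translate p ν f) = 0 ↔ ∀ᵐ t : ℝ, -ν < t → f t = 0 := by
  rw [P_eq_zero_iff]
  constructor
  · intro h
    filter_upwards [(measurePreserving_add_right (volume : Measure ℝ) ν).quasiMeasurePreserving.ae
      (h.and (coeFn_translate ν f))] with t h1 h2
    have h3 := h1.1 (by linarith)
    rwa [h1.2, add_sub_cancel_right] at h3
  · intro h
    filter_upwards [coeFn_translate ν f,
      (measurePreserving_sub_right (volume : Measure ℝ) ν).quasiMeasurePreserving.ae h]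
      with t h1 h2 h3
    rw [h1]
    exact h2 (by linarith)

/-- Both sides are `φ(c - t)`; the cutoff to `(0, c)` in `R` removes nothing, since `φ` vanishes
outside `[0, c]`. -/
theorem J_translate_eq_R {c : ℝ} {φ : LpPlus p}
    (h : ∀ᵐ t : ℝ, c < t → (φ : LpR p) t = 0) :
    J p (translate p (-c) φ) = (R p c φ : LpR p) := by
  have hR : (R p c φ : LpR p) = cut p (Set.Ioo 0 c) measurableSet_Ioo (reflectAt p c φ) := rfl
  rw [hR]
  have hq := (Measure.measurePreserving_sub_left (volume : Measure ℝ) c).quasiMeasurePreserving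
  refine Lp.ext ?_
  filter_upwards [coeFn_J (translate p (-c) (φ : LpR p)),
    (Measure.measurePreserving_neg (volume : Measure ℝ)).quasiMeasurePreserving.ae
      (coeFn_translate (-c) (φ : LpR p)),
    coeFn_cut (Set.Ioo 0 c) measurableSet_Ioo (reflectAt p c φ), coeFn_reflectAt c (φ : LpR p),
    hq.ae h, hq.ae φ.2, ae_ne_zero, hq.ae ae_ne_zero] with t h1 h2 h3 h4 h5 h6 h7 h8
  rw [h1, h2, h3, Set.indicator_apply, h4, show -t - -c = c - t by ring]
  split_ifs with h9
  · rfl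
  · rcases lt_or_gt_of_ne h7 with h10 | h10
    · exact h5 (by linarith)
    · refine h6 (lt_of_le_of_ne ?_ h8)
      by_contra h11
      exact h9 ⟨h10, by linarith⟩

theorem W0_W0_of_mul_eq_one {a b : ℝ → ℂ} (ha : a ∈ G) (hb : b ∈ G) (h : ∀ t, a t * b t = 1)
    (f : LpR p) : W0 p a (W0 p b f) = f := by
  have h1 := (hasSymbol_W0 (p := p) ha).comp (hasSymbol_W0 hb)
  rw [funext h] at h1
  exact DFunLike.congr_fun (h1.unique .id) f

section Factorization

variable {g gp : ℝ → ℂ} {ν : ℝ} {n : ℕ} {σ : ℂ}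

/-- Conjugation by `J` reflects the symbol, so the factor `g₊(-t)⁻¹` becomes `J W⁰(g₊⁻¹) J`; the
rest is multiplicativity and uniqueness. -/
theorem W0_factorization (hg : g ∈ G) (hgp : gp ∈ GPlus) (hgp_inv : (fun t => (gp t)⁻¹) ∈ GPlus)
    (hfact : ∀ t : ℝ, g t = σ * (gp (-t))⁻¹ * Complex.exp (Complex.I * ν * t)
      * cayley t ^ n * gp t) (f : LpR p) :
    W0 p g f = σ • J p (W0 p (fun t => (gp t)⁻¹)
      (J p (translate p ν ((cayleyOp p ^ n) (W0 p gp f))))) := by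
  have h := (((((hasSymbol_W0 (p := p) (GPlus_subset_G hgp_inv)).J_comp_J.smul σ).comp
    (HasSymbol.translate ν)).comp (hasSymbol_cayleyOp.pow n)).comp
    (hasSymbol_W0 (GPlus_subset_G hgp)))
  rw [← funext hfact] at h
  rw [(hasSymbol_W0 hg).unique h]
  rfl

variable (hg : g ∈ G) (hσ : σ ≠ 0) (hgp : gp ∈ GPlus) (hgp_inv : (fun t => (gp t)⁻¹) ∈ GPlus)
  (hgp0 : ∀ t, gp t ≠ 0)
  (hfact : ∀ t : ℝ, g t = σ * (gp (-t))⁻¹ * Complex.exp (Complex.I * ν * t)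
      * cayley t ^ n * gp t)

include hgp hgp_inv hgp0 in
theorem W0_inv_mem_LpPlus_iff (f : LpR p) :
    W0 p (fun t => (gp t)⁻¹) f ∈ LpPlus p ↔ f ∈ LpPlus p := by
  refine ⟨fun h => ?_, W0_mem_LpPlus hgp_inv⟩
  have h1 := W0_mem_LpPlus hgp h
  rwa [W0_W0_of_mul_eq_one (GPlus_subset_G hgp) (GPlus_subset_G hgp_inv)
    fun t => mul_inv_cancel₀ (hgp0 t)] at h1

include hg hσ hgp hgp_inv hgp0 hfact in
-- Being killed by `P` means that the reflection lies in `L^p(ℝ⁺)`. There the two `J` cancel and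
-- `W⁰(g₊⁻¹)` can be dropped, leaving a support condition on a translate.
theorem P_W0_eq_zero_iff (f : LpR p) :
    P p (W0 p g f) = 0 ↔
      ∀ᵐ t : ℝ, -ν < t → ((cayleyOp p ^ n) (W0 p gp f) : LpR p) t = 0 := by
  rw [W0_factorization hg hgp hgp_inv hfact, map_smul, smul_eq_zero_iff_right hσ,
    ← J_mem_LpPlus_iff, J_J, W0_inv_mem_LpPlus_iff hgp hgp_inv hgp0, J_mem_LpPlus_iff,
    P_translate_eq_zero_iff]

include hgp_inv in
-- Both projections are superfluous: the moment conditions keep `C⁻ⁿ φ` in `L^p(ℝ⁺)`, and `W⁰(g₊⁻¹)`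
-- preserves that space.
theorem coe_W_W_of_admissible {c : ℝ} {φ : LpPlus p}
    (hφ : Admissible p c n φ) :
    (W p (fun t => (gp t)⁻¹) (W p (fun t => cayley t ^ (-(n : ℤ))) φ) : LpR p)
      = W0 p (fun t => (gp t)⁻¹) ((cayleyInvOp p ^ n) (φ : LpR p)) := by
  have h1 : (W p (fun t => cayley t ^ (-(n : ℤ))) φ : LpR p) = (cayleyInvOp p ^ n) (φ : LpR p) := by
    rw [← W0_cayley_zpow_neg]
    refine coe_W_of_mem ?_
    rw [W0_cayley_zpow_neg]
    exact (admissible_iff.1 hφ).2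
  rw [coe_W_of_mem (W0_mem_LpPlus hgp_inv (Subtype.prop _)), h1]

include hgp hgp_inv hgp0 in
theorem cayleyOp_pow_W0_W_W {c : ℝ} {φ : LpPlus p} (hφ : Admissible p c n φ) :
    (cayleyOp p ^ n) (W0 p gp
      (W p (fun t => (gp t)⁻¹) (W p (fun t => cayley t ^ (-(n : ℤ))) φ) : LpR p)) = φ := by
  rw [coe_W_W_of_admissible hgp_inv hφ,
    W0_W0_of_mul_eq_one (GPlus_subset_G hgp) (GPlus_subset_G hgp_inv)
      (fun t => mul_inv_cancel₀ (hgp0 t)), cayleyOp_pow_cayleyInvOp_pow]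

include hg hσ hgp hgp_inv hgp0 hfact in
theorem mem_kerW_iff (h : LpPlus p) :
    h ∈ kerW p g ↔ ∃ φ : LpPlus p, Admissible p (-ν) n φ ∧
      h = W p (fun t => (gp t)⁻¹) (W p (fun t => cayley t ^ (-(n : ℤ))) φ) := by
  have h0 : h ∈ kerW p g ↔ P p (W0 p g h) = 0 := by
    rw [LinearMap.mem_ker, ← coe_W]
    exact (ZeroMemClass.coe_eq_zero (x := W p g h)).symm
  rw [h0, P_W0_eq_zero_iff hg hσ hgp hgp_inv hgp0 hfact]
  constructor
  · intro hk
    have hu := W0_mem_LpPlus hgp h.2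
    let φ : LpPlus p := ⟨_, cayleyOp_pow_mem_LpPlus hu n⟩
    have e : (cayleyInvOp p ^ n) (φ : LpR p) = W0 p gp h := cayleyInvOp_pow_cayleyOp_pow n _
    have hφ : Admissible p (-ν) n φ := admissible_iff.2 ⟨hk, by rwa [e]⟩
    refine ⟨φ, hφ, Subtype.ext ?_⟩
    rw [coe_W_W_of_admissible hgp_inv hφ, e, W0_W0_of_mul_eq_one (GPlus_subset_G hgp_inv)
      (GPlus_subset_G hgp) fun t => inv_mul_cancel₀ (hgp0 t)]
  · rintro ⟨φ, hφ, rfl⟩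
    rw [cayleyOp_pow_W0_W_W hgp hgp_inv hgp0 hφ]
    exact (admissible_iff.1 hφ).1

include hg hgp hgp_inv hgp0 hfact in
theorem J_W0_eq {φ : LpPlus p} (hφ : Admissible p (-ν) n φ) :
    J p (W0 p g (W p (fun t => (gp t)⁻¹) (W p (fun t => cayley t ^ (-(n : ℤ))) φ) : LpR p))
      = σ • (W p (fun t => (gp t)⁻¹) (R p (-ν) φ) : LpR p) := by
  rw [W0_factorization hg hgp hgp_inv hfact, cayleyOp_pow_W0_W_W hgp hgp_inv hgp0 hφ, map_smul,
    J_J, coe_W_of_mem (W0_mem_LpPlus hgp_inv (Subtype.prop _)),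
    ← J_translate_eq_R (admissible_iff.1 hφ).1, neg_neg]

include hg hgp hgp_inv hgp0 hfact in
theorem J_Q_W0_P_eq (h : kerW p g) {φ : LpPlus p} (hφ : Admissible p (-ν) n φ)
    (hh : (h : LpPlus p)
      = W p (fun t => (gp t)⁻¹) (W p (fun t => cayley t ^ (-(n : ℤ))) φ)) :
    J p (Q p (W0 p g (P p ((h : LpPlus p) : LpR p))))
      = σ • (W p (fun t => (gp t)⁻¹) (R p (-ν) φ) : LpR p) := by
  have h0 : P p (W0 p g (h : LpPlus p)) = 0 := by
    rw [← coe_W]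
    exact congrArg Subtype.val (LinearMap.mem_ker.1 h.2)
  -- On `ker W(g)` the image under `W⁰(g)` has no part on the positive axis, so `Q` acts on it as
  -- the identity.
  have hQ : Q p (W0 p g (h : LpPlus p)) = W0 p g (h : LpPlus p) := by
    rw [Q, _root_.sub_apply, h0, sub_zero]
    rfl
  rw [P_eq_self_iff.2 (h : LpPlus p).2, hQ, hh, J_W0_eq hg hgp hgp_inv hgp0 hfact hφ]

end Factorization

end WienerHopf

end

open WienerHopf in
theorem theorem2p5 (p : ℝ≥0∞) [Fact (1 ≤ p)] (g gp : ℝ → ℂ) (ν : ℝ) (n : ℕ)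
    (hν : ν < 0) (hn : 0 < n) (hg : IsMatching g)
    (hgp : gp ∈ GPlus) (hgp_inv : (fun t => (gp t)⁻¹) ∈ GPlus)
    (hfact : ∀ t : ℝ, g t = sigma g n * (gp (-t))⁻¹ * Complex.exp (Complex.I * ν * t)
      * cayley t ^ n * gp t) :
    (∀ h : LpPlus p, h ∈ kerW p g ↔ ∃ φ : LpPlus p, Admissible p |ν| n φ ∧
      h = W p (fun t => (gp t)⁻¹) (W p (fun t => cayley t ^ (-(n : ℤ))) φ)) ∧
    ∀ (h : kerW p g) (φ : LpPlus p), Admissible p |ν| n φ →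
      (h : LpPlus p) = W p (fun t => (gp t)⁻¹) (W p (fun t => cayley t ^ (-(n : ℤ))) φ) →
      J p (Q p (W0 p g (P p ((h : LpPlus p) : LpR p))))
          = sigma g n • (W p (fun t => (gp t)⁻¹) (R p |ν| φ) : LpR p) ∧
      PPplus p g h
          = (1 / 2 : ℂ) • ((h : LpPlus p) + sigma g n • W p (fun t => (gp t)⁻¹) (R p |ν| φ)) ∧
      PPminus p g h
          = (1 / 2 : ℂ) • ((h : LpPlus p) - sigma g n • W p (fun t => (gp t)⁻¹) (R p |ν| φ)) := by
  have hg0 : ∀ t, g t ≠ 0 := fun t => left_ne_zero_of_mul_eq_one (hg.2 t)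
  have hσ : sigma g n ≠ 0 := mul_ne_zero (pow_ne_zero _ (by norm_num)) (hg0 0)
  -- With the convention `0⁻¹ = 0`, a pointwise inverse does not by itself exclude zeros of `gp`;
  -- the matching condition does, through the factorization.
  have hgp0 : ∀ t, gp t ≠ 0 := fun t h => hg0 t (by rw [hfact, h, mul_zero])
  rw [abs_of_neg hν]
  refine ⟨mem_kerW_iff hg.1 hσ hgp hgp_inv hgp0 hfact, fun h φ hφ hh => ?_⟩
  have key := J_Q_W0_P_eq hg.1 hgp hgp_inv hgp0 hfact h hφ hh
  have hPP : PP p g h = sigma g n • W p (fun t => (gp t)⁻¹) (R p (-ν) φ) := Subtype.ext key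
  refine ⟨key, ?_, ?_⟩
  · rw [← hPP]
    rfl
  · rw [← hPP]
    rfl
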